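/- **Conventions.** Fix a countably infinite set of variables. $\sim$-formulae are built from variables by $\bot,\top,\land,\lor,\to,\boxtimes$; $\mathit{clm}$-formulae are built by $\bot,\top,\land,\neg,\square$, with $\lor,\to$ the usual abbreviations and $\square^+\varphi:=\square\varphi\land\varphi$. A rule $\Gamma/\Delta$ is a pair of finite sets of formulae. A *rule system* (in either signature) is a set of rules closed under substitution, monotonicity ($\Gamma/\Delta$ gives $\Gamma\cup\Gamma'/\Delta\cup\Delta'$) and cut (from $\Gamma/\Delta,\varphi$ and $\Gamma,\varphi/\Delta$ infer $\Gamma/\Delta$), and containing $\varphi/\varphi$, modus ponens $\varphi,\varphi\to\psi/\psi$ and necessitation $\varphi/\boxtimes\varphi$ (resp. $\varphi/\square\varphi$) for all formulae $\varphi,\psi$. For sets of rules $\Xi,\Sigma$, $\Xi\oplus\Sigma$ is the least rule system containing both. A *logic* is a rule system that is the least one containing some set of rules of the form $/\varphi$. For a logic $\mathsf L$, $\mathrm{NExtL}(\mathsf L)$ is the set of all logics containing $\mathsf L$, ordered by inclusion; it is a complete lattice. * $\mathsf{mHC}$ is the least $\sim$-rule system containing $/\varphi$ for all theorems $\varphi$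 of the intuitionistic propositional calculus and the rules $/\boxtimes(p\to q)\to(\boxtimes p\to\boxtimes q)$, $/p\to\boxtimes p$, $/\boxtimes p\to(q\lor(q\to p))$; $\mathsf{KM}:=\mathsf{mHC}\oplus\{/(\boxtimes p\to p)\to p\}$. * $\mathsf{K4}$ is the least $\mathit{clm}$-rule system containing $/\varphi$ for every $\varphi$ valid in all transitive Kripke frames; $\mathsf{K4.Grz}:=\mathsf{K4}\oplus\{/\square(\square(p\to\square p)\to p)\to\square p\}$; $\mathsf{GL}:=\mathsf{K4}\oplus\{/\square(\square p\to p)\to\square p\}$. Define $T$ from $\sim$-formulae to $\mathit{clm}$-formulae by $T(p)=\square^+p$, $T(\bot)=\bot$, $T(\top)=\top$, $T(\varphi\land\psi)=T(\varphi)\land T(\psi)$, $T(\varphi\lor\psi)=T(\varphi)\lor T(\psi)$, $T(\varphi\to\psi)=\square^+(\neg T(\varphi)\lor T(\psi))$, $T(\boxtimes\varphi)=\square T(\varphi)$, and $T(\Gamma/\Delta)=T[\Gamma]/T[\Delta]$. Put $$\tau\mathsf L:=\mathsf{K4}\oplus\{T(\Gamma/\Delta):\Gamma/\Delta\in\mathsf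 L\},\qquad \sigma\mathsf L:=\mathsf{K4.Grz}\oplus\tau\mathsf L,\qquad \rho\mathsf M:=\{\Gamma/\Delta: T(\Gamma/\Delta)\in\mathsf M\}.$$ **Theorem.** 1. (Kuznetsov–Muravitsky isomorphism) $\sigma$ restricts to a map $\mathrm{NExtL}(\mathsf{KM})\to\mathrm{NExtL}(\mathsf{GL})$ and $\rho$ restricts to a map $\mathrm{NExtL}(\mathsf{GL})\to\mathrm{NExtL}(\mathsf{KM})$, and these restrictions are mutually inverse complete lattice isomorphisms (they preserve arbitrary joins and meets). 2. (Esakia theorem) $\sigma$ restricts to a map $\mathrm{NExtL}(\mathsf{mHC})\to\mathrm{NExtL}(\mathsf{K4.Grz})$ and $\rho$ restricts to a map $\mathrm{NExtL}(\mathsf{K4.Grz})\to\mathrm{NExtL}(\mathsf{mHC})$, and these restrictions are mutually inverse complete lattice isomorphisms (they preserve arbitrary joins and meets). -/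

import Mathlib

namespace KuzMur

/-! ## Formulae -/

/-- Formulae of intuitionistic propositional logic over the countably infinite set of
variables `ℕ`. -/
inductive PForm : Type
  | var : ℕ → PForm
  | bot : PForm
  | top : PForm
  | and : PForm → PForm → PForm
  | or : PForm → PForm → PForm
  | imp : PForm → PForm → PForm

/-- Superintuitionistic modal formulae; `box` is the modality `⊠`. -/
inductive IForm : Type
  | var : ℕ → IForm
  | bot : IForm
  | top : IForm
  | and : IForm → IForm → IForm
  | or : IForm → IForm → IForm
  | imp : IForm → IForm → IForm
  | box : IForm → IForm
  deriving DecidableEq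

/-- Classical modal formulae, with primitive connectives `⊥, ⊤, ∧, ¬, □`. -/
inductive CForm : Type
  | var : ℕ → CForm
  | bot : CForm
  | top : CForm
  | and : CForm → CForm → CForm
  | neg : CForm → CForm
  | box : CForm → CForm
  deriving DecidableEq

/-- Disjunction, as an abbreviation. -/
def CForm.or (φ ψ : CForm) : CForm := .neg (.and (.neg φ) (.neg ψ))

/-- Implication, as an abbreviation. -/
def CForm.imp (φ ψ : CForm) : CForm := .neg (.and φ (.neg ψ))

/-- The defined modality `□⁺φ := □φ ∧ φ`. -/
def CForm.boxPlus (φ : CForm) : CForm := .and (.box φ) φ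

/-- The extension of a map on variables to all formulae, commuting with all connectives. -/
def IForm.subst (s : ℕ → IForm) : IForm → IForm
  | .var n => s n
  | .bot => .bot
  | .top => .top
  | .and φ ψ => .and (φ.subst s) (ψ.subst s)
  | .or φ ψ => .or (φ.subst s) (ψ.subst s)
  | .imp φ ψ => .imp (φ.subst s) (ψ.subst s)
  | .box φ => .box (φ.subst s)

/-- The extension of a map on variables to all formulae, commuting with all connectives. -/
def CForm.subst (s : ℕ → CForm) : CForm → CForm
  | .var n => s n
  | .bot => .bot
  | .top => .top
  | .and φ ψ => .and (φ.subst s) (ψ.subst s)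
  | .neg φ => .neg (φ.subst s)
  | .box φ => .box (φ.subst s)

/-- The syntactic operations in terms of which rule systems are defined. It has exactly two
instances, `IForm` and `CForm`, and only serves to treat them uniformly. -/
class Signature (F : Type) where
  subst : (ℕ → F) → F → F
  imp : F → F → F
  box : F → F

instance : Signature IForm := ⟨IForm.subst, IForm.imp, IForm.box⟩

instance : Signature CForm := ⟨CForm.subst, CForm.imp, CForm.box⟩

/-! ## Rules, rule systems and logics -/

/-- A multi-conclusion rule `Γ/Δ`. -/
abbrev Rule (F : Type) : Type := Finset F × Finset F

section RuleSystems

variable {F : Type} [DecidableEq F] [Signature F]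

/-- `S` is a rule system. -/
structure IsRuleSystem (S : Set (Rule F)) : Prop where
  structurality : ∀ (s : ℕ → F) (Γ Δ : Finset F), (Γ, Δ) ∈ S →
    (Γ.image (Signature.subst s), Δ.image (Signature.subst s)) ∈ S
  reflexivity : ∀ φ : F, (({φ}, {φ}) : Rule F) ∈ S
  monotonicity : ∀ Γ Δ Γ' Δ' : Finset F, (Γ, Δ) ∈ S → (Γ ∪ Γ', Δ ∪ Δ') ∈ S
  cut : ∀ (Γ Δ : Finset F) (φ : F), (Γ, insert φ Δ) ∈ S → (insert φ Γ, Δ) ∈ S → (Γ, Δ) ∈ S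
  modusPonens : ∀ φ ψ : F, (({φ, Signature.imp φ ψ}, {ψ}) : Rule F) ∈ S
  necessitation : ∀ φ : F, (({φ}, {Signature.box φ}) : Rule F) ∈ S

variable (F) in
/-- The type of all rule systems. -/
def RuleSystem : Type := {S : Set (Rule F) // IsRuleSystem S}

/-- Rule systems are ordered by inclusion. -/
instance : PartialOrder (RuleSystem F) :=
  inferInstanceAs (PartialOrder {S : Set (Rule F) // IsRuleSystem S})

/-- The set of rules of a rule system. -/
def RuleSystem.rules (S : RuleSystem F) : Set (Rule F) := S.1

theorem isRuleSystem_sInter (C : Set (Set (Rule F))) (hC : ∀ S ∈ C, IsRuleSystem S) :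
    IsRuleSystem (⋂₀ C) where
  structurality s Γ Δ h S hS := (hC S hS).structurality s Γ Δ (h S hS)
  reflexivity φ S hS := (hC S hS).reflexivity φ
  monotonicity Γ Δ Γ' Δ' h S hS := (hC S hS).monotonicity Γ Δ Γ' Δ' (h S hS)
  cut Γ Δ φ h₁ h₂ S hS := (hC S hS).cut Γ Δ φ (h₁ S hS) (h₂ S hS)
  modusPonens φ ψ S hS := (hC S hS).modusPonens φ ψ
  necessitation φ S hS := (hC S hS).necessitation φ

/-- The least rule system containing the set of rules `R`, i.e. the rule system axiomatized
by `R`. -/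
def axiomatized (R : Set (Rule F)) : RuleSystem F :=
  ⟨⋂₀ {S | IsRuleSystem S ∧ R ⊆ S}, isRuleSystem_sInter _ fun _ hS => hS.1⟩

theorem subset_axiomatized (R : Set (Rule F)) : R ⊆ (axiomatized R).rules :=
  fun _ hr _ hS => hS.2 hr

theorem axiomatized_le {R : Set (Rule F)} {S : RuleSystem F} :
    axiomatized R ≤ S ↔ R ⊆ S.rules :=
  ⟨fun h _ hr => h (subset_axiomatized R hr), fun h _ hr => hr S.1 ⟨S.2, h⟩⟩

/-- `Ξ ⊕ Σ`: the least rule system containing both sets of rules. -/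
def oplus (R R' : Set (Rule F)) : RuleSystem F := axiomatized (R ∪ R')

/-- The assumption-free single-conclusion rule `/φ`. -/
def thm (φ : F) : Rule F := (∅, {φ})

/-- A logic is a rule system axiomatized by a set of rules of the form `/φ`. -/
def IsLogic (S : RuleSystem F) : Prop := ∃ Φ : Set F, S = axiomatized (thm '' Φ)

/-- `Taut S` is the logic axiomatized by the rules `/φ` that belong to `S`. -/
def Taut (S : RuleSystem F) : RuleSystem F := axiomatized (thm '' {φ | thm φ ∈ S.rules})

/-- The set of all logics extending `L`, ordered by inclusion. -/
def NExtL (L : RuleSystem F) : Type := {S : RuleSystem F // IsLogic S ∧ L ≤ S}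

instance (L : RuleSystem F) : PartialOrder (NExtL L) :=
  inferInstanceAs (PartialOrder {S : RuleSystem F // IsLogic S ∧ L ≤ S})

/-- The underlying rule system of a member of `NExtL L`. -/
def NExtL.toRuleSystem {L : RuleSystem F} (S : NExtL L) : RuleSystem F := S.1

theorem isLogic_taut (S : RuleSystem F) : IsLogic (Taut S) := ⟨_, rfl⟩

theorem taut_le (S : RuleSystem F) : Taut S ≤ S :=
  axiomatized_le.2 (Set.image_subset_iff.2 fun _ h => h)

theorem IsLogic.le_taut {L S : RuleSystem F} (hL : IsLogic L) (h : L ≤ S) : L ≤ Taut S := by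
  obtain ⟨Φ, rfl⟩ := hL
  refine axiomatized_le.2 ?_
  rintro _ ⟨φ, hφ, rfl⟩
  exact subset_axiomatized _ ⟨φ, axiomatized_le.1 h ⟨φ, hφ, rfl⟩, rfl⟩

/-- The join of any family of logics, taken among rule systems, is a logic. -/
theorem isLogic_axiomatized_sUnion (C : Set (RuleSystem F)) (hC : ∀ S ∈ C, IsLogic S) :
    IsLogic (axiomatized (⋃ S ∈ C, S.rules)) := by
  refine ⟨_, le_antisymm (axiomatized_le.2 (Set.iUnion₂_subset fun S hS => ?_)) (taut_le _)⟩
  exact (hC S hS).le_taut fun _ hr => subset_axiomatized _ (Set.mem_biUnion hS hr)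

theorem IsLogic.oplus {L : RuleSystem F} (hL : IsLogic L) (Φ : Set F) :
    IsLogic (oplus L.rules (thm '' Φ)) := by
  have h := isLogic_axiomatized_sUnion {L, axiomatized (thm '' Φ)}
    (by rintro S (rfl | rfl); exacts [hL, ⟨Φ, rfl⟩])
  have e : KuzMur.oplus L.rules (thm '' Φ) =
      axiomatized (⋃ S ∈ ({L, axiomatized (thm '' Φ)} : Set (RuleSystem F)), S.rules) := by
    rw [Set.biUnion_pair]
    refine le_antisymm (axiomatized_le.2 ?_) (axiomatized_le.2 ?_)
    · exact (Set.union_subset_union_right _ (subset_axiomatized _)).trans (subset_axiomatized _)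
    · refine Set.union_subset (Set.subset_union_left.trans (subset_axiomatized _)) ?_
      exact axiomatized_le.2 (Set.subset_union_right.trans (subset_axiomatized _))
  rwa [e]

/-- Joins in `NExtL L` are joins of rule systems. -/
instance (L : RuleSystem F) [hL : Fact (IsLogic L)] : SupSet (NExtL L) :=
  ⟨fun C => ⟨axiomatized (⋃ S ∈ insert L (NExtL.toRuleSystem '' C), S.rules),
    isLogic_axiomatized_sUnion _ (by
      rintro S (rfl | ⟨T, -, rfl⟩)
      exacts [hL.out, T.2.1]),
    fun _ hr => subset_axiomatized _ (Set.mem_biUnion (Set.mem_insert _ _) hr)⟩⟩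

/-- Meets in `NExtL L` are obtained from intersections by applying `Taut`. -/
instance (L : RuleSystem F) [hL : Fact (IsLogic L)] : InfSet (NExtL L) :=
  ⟨fun C => ⟨Taut ⟨⋂₀ ((fun S : NExtL L => S.toRuleSystem.rules) '' C),
      isRuleSystem_sInter _ (by rintro _ ⟨S, -, rfl⟩; exact S.1.2)⟩,
    isLogic_taut _,
    hL.out.le_taut (by rintro r hr _ ⟨S, -, rfl⟩; exact S.2.2 hr)⟩⟩

/-- `NExtL L` is a complete lattice with respect to inclusion, for every logic `L`. -/
instance (L : RuleSystem F) [hL : Fact (IsLogic L)] : CompleteLattice (NExtL L) where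
  __ := completeLatticeOfSup (NExtL L) fun C => by
    constructor
    · intro S hS r hr
      exact subset_axiomatized _
        (Set.mem_biUnion (Set.mem_insert_of_mem _ (Set.mem_image_of_mem _ hS)) hr)
    · intro T hT
      refine axiomatized_le.2 (Set.iUnion₂_subset ?_)
      rintro _ (rfl | ⟨S, hS, rfl⟩)
      exacts [T.2.2, hT hS]
  sInf := sInf
  isGLB_sInf C := by
    constructor
    · intro S hS r hr
      exact taut_le _ hr _ ⟨S, hS, rfl⟩
    · intro T hT
      refine T.2.1.le_taut ?_
      rintro r hr _ ⟨S, hS, rfl⟩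
      exact hT hS hr

end RuleSystems

/-! ## The systems `mHC` and `KM` -/

/-- The theorems of the intuitionistic propositional calculus. -/
inductive IPC : PForm → Prop
  | k (φ ψ : PForm) : IPC (.imp φ (.imp ψ φ))
  | s (φ ψ χ : PForm) : IPC (.imp (.imp φ (.imp ψ χ)) (.imp (.imp φ ψ) (.imp φ χ)))
  | andLeft (φ ψ : PForm) : IPC (.imp (.and φ ψ) φ)
  | andRight (φ ψ : PForm) : IPC (.imp (.and φ ψ) ψ)
  | andIntro (φ ψ : PForm) : IPC (.imp φ (.imp ψ (.and φ ψ)))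
  | orLeft (φ ψ : PForm) : IPC (.imp φ (.or φ ψ))
  | orRight (φ ψ : PForm) : IPC (.imp ψ (.or φ ψ))
  | orElim (φ ψ χ : PForm) : IPC (.imp (.imp φ χ) (.imp (.imp ψ χ) (.imp (.or φ ψ) χ)))
  | exFalso (φ : PForm) : IPC (.imp .bot φ)
  | truth : IPC .top
  | mp (φ ψ : PForm) : IPC (.imp φ ψ) → IPC φ → IPC ψ

/-- Propositional formulae as superintuitionistic modal formulae. -/
def PForm.toIForm : PForm → IForm
  | .var n => .var n
  | .bot => .bot
  | .top => .top
  | .and φ ψ => .and φ.toIForm ψ.toIForm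
  | .or φ ψ => .or φ.toIForm ψ.toIForm
  | .imp φ ψ => .imp φ.toIForm ψ.toIForm

/-- The three modal axioms of `mHC`, with `p = var 0` and `q = var 1`:
`⊠(p → q) → (⊠p → ⊠q)`, `p → ⊠p` and `⊠p → (q ∨ (q → p))`. -/
def mHCAxioms : Set IForm :=
  {.imp (.box (.imp (.var 0) (.var 1))) (.imp (.box (.var 0)) (.box (.var 1))),
   .imp (.var 0) (.box (.var 0)),
   .imp (.box (.var 0)) (.or (.var 1) (.imp (.var 1) (.var 0)))}

/-- The modalized Heyting calculus. -/
def mHC : RuleSystem IForm := axiomatized (thm '' (PForm.toIForm '' {φ | IPC φ} ∪ mHCAxioms))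

/-- The Kuznetsov–Muravitsky system: `mHC` with the additional axiom `(⊠p → p) → p`. -/
def KM : RuleSystem IForm :=
  oplus mHC.rules (thm '' {.imp (.imp (.box (.var 0)) (.var 0)) (.var 0)})

/-! ## The systems `K4`, `K4.Grz` and `GL` -/

/-- Truth of a classical modal formula at a point of a Kripke model `(W, R, V)`. -/
def CForm.Sat {W : Type} (R : W → W → Prop) (V : ℕ → W → Prop) : CForm → W → Prop
  | .var n, w => V n w
  | .bot, _ => False
  | .top, _ => True
  | .and φ ψ, w => φ.Sat R V w ∧ ψ.Sat R V w
  | .neg φ, w => ¬ φ.Sat R V w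
  | .box φ, w => ∀ v, R w v → φ.Sat R V v

/-- Validity in all transitive Kripke frames. -/
def CForm.TransitiveValid (φ : CForm) : Prop :=
  ∀ (W : Type) (R : W → W → Prop), (∀ x y z, R x y → R y z → R x z) →
    ∀ (V : ℕ → W → Prop) (w : W), φ.Sat R V w

/-- The system `K4`. -/
def K4 : RuleSystem CForm := axiomatized (thm '' {φ | φ.TransitiveValid})

/-- The system `K4.Grz`: `K4` with the additional axiom `□(□(p → □p) → p) → □p`. -/
def K4Grz : RuleSystem CForm :=
  oplus K4.rules (thm '' {CForm.imp
    (.box (CForm.imp (.box (CForm.imp (.var 0) (.box (.var 0)))) (.var 0))) (.box (.var 0))})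

/-- The Gödel–Löb system `GL`: `K4` with the additional axiom `□(□p → p) → □p`. -/
def GodelLob : RuleSystem CForm :=
  oplus K4.rules (thm '' {CForm.imp
    (.box (CForm.imp (.box (.var 0)) (.var 0))) (.box (.var 0))})

instance : Fact (IsLogic mHC) := ⟨_, rfl⟩

instance : Fact (IsLogic K4) := ⟨_, rfl⟩

instance : Fact (IsLogic KM) := ⟨IsLogic.oplus (Fact.out : IsLogic mHC) _⟩

instance : Fact (IsLogic K4Grz) := ⟨IsLogic.oplus (Fact.out : IsLogic K4) _⟩

instance : Fact (IsLogic GodelLob) := ⟨IsLogic.oplus (Fact.out : IsLogic K4) _⟩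

/-! ## The translation and the maps it induces -/

/-- The translation `T` of superintuitionistic modal formulae into classical modal formulae. -/
def T : IForm → CForm
  | .var n => .boxPlus (.var n)
  | .bot => .bot
  | .top => .top
  | .and φ ψ => .and (T φ) (T ψ)
  | .or φ ψ => .or (T φ) (T ψ)
  | .imp φ ψ => .boxPlus (.or (.neg (T φ)) (T ψ))
  | .box φ => .box (T φ)

/-- The translation of rules, `T(Γ/Δ) = T[Γ]/T[Δ]`. -/
def TRule (r : Rule IForm) : Rule CForm := (r.1.image T, r.2.image T)

/-- `τL = K4 ⊕ {T(Γ/Δ) : Γ/Δ ∈ L}`. -/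
def tau (L : RuleSystem IForm) : RuleSystem CForm := oplus K4.rules (TRule '' L.rules)

/-- `σL = K4.Grz ⊕ τL`. -/
def sigma (L : RuleSystem IForm) : RuleSystem CForm := oplus K4Grz.rules (tau L).rules

/-- `ρM = {Γ/Δ : T(Γ/Δ) ∈ M}`. -/
def rho (M : RuleSystem CForm) : Set (Rule IForm) := {r | TRule r ∈ M.rules}

end KuzMur

/-! Both parts are instances of one order isomorphism, `sigmaIso`; an order isomorphism between
complete lattices preserves all joins and meets. A logic is determined by its theorems: Γ/Δ belongs
to it iff some member of Δ is derivable from Γ. Translations are persistent along the accessibility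
relation, so translated hypotheses obey a deduction theorem, and ρM is the logic of the formulae
whose translations are theorems of M (`rho_eq`). Two identities between sets of theorems remain.

ρσL = L (`pullback_sigma`). In the canonical frame of prime theories of L, the axiom ⊠p → (q ∨ (q →
p)) makes every proper inclusion an accessibility, so Tφ holds at x iff φ ∈ x. Variables are
evaluated only by skeletal formulae, the Boolean combinations of translations. Their truth values
stabilize along chains, so Zorn's lemma gives maximal refuting points, and these validate the Grz
axiom.

σρM = M (`sigma_rho`). If φ is not a theorem of an extension of K4.Grz, some skeletal b and some s
keep φ[b][s] a non-theorem (`World.exists_skeletal_notMem`). Since □⁺(φ[b]) is equivalent to a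
translation, and σρM contains every translation in M, no theorem of M is missing from σρM. To find b
and s, call the trace of a canonical point on the subformulae of φ its type. By Grz, every type seen
from x is seen from x at a point passive for it, one from which the type cannot be left and entered
again. Each point gets a base point: itself if passive for its own type, otherwise a fixed
representative with the same boxed subformulae. The valuation read off at base points is skeletal,
and a truth lemma holds for it.

For KM and GL it remains to derive each of the two extra axioms from the other through T. -/

namespace KuzMur

/-! ### Derivations, theories and Lindenbaum's lemma in either signature -/

section Derivations

/-- Substitution commutes with the operations of the signature. -/
class LawfulSignature (F : Type) [Signature F] : Prop where
  subst_imp : ∀ (s : ℕ → F) (φ ψ : F), Signature.subst s (Signature.imp φ ψ) =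
    Signature.imp (Signature.subst s φ) (Signature.subst s ψ)
  subst_box : ∀ (s : ℕ → F) (φ : F), Signature.subst s (Signature.box φ) =
    Signature.box (Signature.subst s φ)

instance : LawfulSignature IForm := ⟨fun _ _ _ => rfl, fun _ _ => rfl⟩

instance : LawfulSignature CForm := ⟨fun _ _ _ => rfl, fun _ _ => rfl⟩

variable {F : Type} [Signature F]

/-- Derivability from axioms `Φ` and hypotheses `Γ` by modus ponens and necessitation. -/
inductive Der (Φ Γ : Set F) : F → Prop
  | ax {φ : F} : φ ∈ Φ → Der Φ Γ φ
  | hyp {φ : F} : φ ∈ Γ → Der Φ Γ φ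
  | mp {φ ψ : F} : Der Φ Γ φ → Der Φ Γ (Signature.imp φ ψ) → Der Φ Γ ψ
  | nec {φ : F} : Der Φ Γ φ → Der Φ Γ (Signature.box φ)

theorem Der.trans {Φ Γ Γ' : Set F} {φ : F} (h : Der Φ Γ φ) (hΓ : ∀ γ ∈ Γ, Der Φ Γ' γ) :
    Der Φ Γ' φ := by
  induction h with
  | ax h => exact .ax h
  | hyp h => exact hΓ _ h
  | mp _ _ h₁ h₂ => exact .mp h₁ h₂
  | nec _ h => exact .nec h

theorem Der.subst [LawfulSignature F] {Φ Γ : Set F} {φ : F} (s : ℕ → F)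
    (hΦ : ∀ φ ∈ Φ, Signature.subst s φ ∈ Φ) (h : Der Φ Γ φ) :
    Der Φ (Signature.subst s '' Γ) (Signature.subst s φ) := by
  induction h with
  | ax h => exact .ax (hΦ _ h)
  | hyp h => exact .hyp ⟨_, h, rfl⟩
  | mp _ _ h₁ h₂ => exact .mp h₁ (LawfulSignature.subst_imp s _ _ ▸ h₂)
  | nec _ h => exact LawfulSignature.subst_box s _ ▸ .nec h

variable [DecidableEq F]

/-- The theorems of a rule system. -/
def RuleSystem.theorems (S : RuleSystem F) : Set F := {φ | thm φ ∈ S.rules}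

namespace RuleSystem

theorem mono (S : RuleSystem F) {Γ Δ Γ' Δ' : Finset F} (h : (Γ, Δ) ∈ S.rules) (hΓ : Γ ⊆ Γ')
    (hΔ : Δ ⊆ Δ') : (Γ', Δ') ∈ S.rules := by
  have := S.2.monotonicity Γ Δ Γ' Δ' h
  rwa [Finset.union_eq_right.2 hΓ, Finset.union_eq_right.2 hΔ] at this

theorem cut_two (S : RuleSystem F) {Γ : Finset F} {φ ψ χ : F} (h₁ : (Γ, {φ}) ∈ S.rules)
    (h₂ : (Γ, {ψ}) ∈ S.rules) (h : (({φ, ψ}, {χ}) : Rule F) ∈ S.rules) :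
    (Γ, {χ}) ∈ S.rules := by
  refine S.2.cut _ _ φ (S.mono h₁ subset_rfl (by simp)) ?_
  refine S.2.cut _ _ ψ (S.mono h₂ (by simp) (by simp)) (S.mono h ?_ subset_rfl)
  intro x
  simp only [Finset.mem_insert, Finset.mem_singleton]
  tauto

theorem mem_nec (S : RuleSystem F) {Γ : Finset F} {φ : F} (h : (Γ, {φ}) ∈ S.rules) :
    (Γ, {Signature.box φ}) ∈ S.rules := by
  refine S.cut_two h h ?_
  rw [Finset.insert_eq_of_mem (Finset.mem_singleton_self φ)]
  exact S.2.necessitation φ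

theorem mem_of_der (S : RuleSystem F) {Φ : Set F} (hΦ : Φ ⊆ S.theorems) {Γ : Finset F} {φ : F}
    (h : Der Φ Γ φ) : (Γ, {φ}) ∈ S.rules := by
  induction h with
  | ax h => exact S.mono (hΦ h) (by simp) subset_rfl
  | hyp h => exact S.mono (S.2.reflexivity _) (by simpa using h) subset_rfl
  | mp _ _ h₁ h₂ => exact S.cut_two h₁ h₂ (S.2.modusPonens _ _)
  | nec _ h => exact S.mem_nec h

theorem theorems_mp (S : RuleSystem F) {φ ψ : F} (h : Signature.imp φ ψ ∈ S.theorems)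
    (hφ : φ ∈ S.theorems) : ψ ∈ S.theorems :=
  S.cut_two hφ h (S.2.modusPonens _ _)

theorem theorems_nec (S : RuleSystem F) {φ : F} (h : φ ∈ S.theorems) :
    Signature.box φ ∈ S.theorems :=
  S.mem_nec h

theorem theorems_subst (S : RuleSystem F) {φ : F} (s : ℕ → F) (h : φ ∈ S.theorems) :
    Signature.subst s φ ∈ S.theorems := by
  have := S.2.structurality s _ _ h
  rwa [Finset.image_empty, Finset.image_singleton] at this

theorem theorems_mono {S S' : RuleSystem F} (h : S ≤ S') : S.theorems ⊆ S'.theorems :=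
  fun _ hφ => h hφ

theorem axiomatized_thm_le {S : RuleSystem F} {Φ : Set F} :
    axiomatized (thm '' Φ) ≤ S ↔ Φ ⊆ S.theorems :=
  axiomatized_le.trans Set.image_subset_iff

end RuleSystem

theorem IsLogic.eq_axiomatized {L : RuleSystem F} (hL : IsLogic L) :
    L = axiomatized (thm '' L.theorems) :=
  le_antisymm (hL.le_taut le_rfl) (taut_le L)

theorem IsLogic.le_iff {L S : RuleSystem F} (hL : IsLogic L) :
    L ≤ S ↔ L.theorems ⊆ S.theorems := by
  refine ⟨RuleSystem.theorems_mono, fun h => ?_⟩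
  rw [hL.eq_axiomatized]
  exact RuleSystem.axiomatized_thm_le.2 h

theorem oplus_le {R R' : Set (Rule F)} {S : RuleSystem F} :
    oplus R R' ≤ S ↔ R ⊆ S.rules ∧ R' ⊆ S.rules :=
  axiomatized_le.trans Set.union_subset_iff

theorem left_subset_oplus (R R' : Set (Rule F)) : R ⊆ (oplus R R').rules :=
  Set.subset_union_left.trans (subset_axiomatized _)

/-- The rules with a derivable conclusion already form a rule system: for cut, if the conclusion
derived is the cut formula itself, its derivation replaces that hypothesis. Multiple conclusions
thus add nothing to a logic. -/
theorem mem_axiomatized_thm [LawfulSignature F] {Φ : Set F}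
    (hΦ : ∀ s : ℕ → F, ∀ φ ∈ Φ, Signature.subst s φ ∈ Φ) {Γ Δ : Finset F} :
    (Γ, Δ) ∈ (axiomatized (thm '' Φ)).rules ↔ ∃ δ ∈ Δ, Der Φ Γ δ := by
  constructor
  · intro h
    refine h {r | ∃ δ ∈ r.2, Der Φ r.1 δ} ⟨⟨?_, ?_, ?_, ?_, ?_, ?_⟩, ?_⟩
    · rintro s Γ Δ ⟨δ, hδ, h⟩
      refine ⟨_, Finset.mem_image_of_mem _ hδ, ?_⟩
      simpa using h.subst s (hΦ s)
    · exact fun φ => ⟨φ, by simp, .hyp (by simp)⟩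
    · rintro Γ Δ Γ' Δ' ⟨δ, hδ, h⟩
      exact ⟨δ, Finset.mem_union_left _ hδ, h.trans fun γ hγ => .hyp (by simp_all)⟩
    · rintro Γ Δ φ ⟨δ, hδ, h⟩ ⟨δ', hδ', h'⟩
      rcases Finset.mem_insert.1 hδ with rfl | hδ
      · refine ⟨δ', hδ', h'.trans fun γ hγ => ?_⟩
        rcases Finset.mem_insert.1 (Finset.mem_coe.1 hγ) with rfl | hγ
        exacts [h, .hyp hγ]
      · exact ⟨δ, hδ, h⟩
    · exact fun φ ψ => ⟨ψ, by simp, .mp (φ := φ) (.hyp (by simp)) (.hyp (by simp))⟩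
    · exact fun φ => ⟨Signature.box φ, by simp, .nec (.hyp (by simp))⟩
    · rintro _ ⟨φ, hφ, rfl⟩
      exact ⟨φ, by simp [thm], .ax hφ⟩
  · rintro ⟨δ, hδ, h⟩
    exact (axiomatized (thm '' Φ)).mono
      (RuleSystem.mem_of_der _ (RuleSystem.axiomatized_thm_le.1 le_rfl) h) subset_rfl (by simpa)

theorem IsLogic.mem_rules_iff [LawfulSignature F] {L : RuleSystem F} (hL : IsLogic L)
    {Γ Δ : Finset F} : (Γ, Δ) ∈ L.rules ↔ ∃ δ ∈ Δ, Der L.theorems Γ δ := by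
  conv_lhs => rw [hL.eq_axiomatized]
  exact mem_axiomatized_thm fun s φ => L.theorems_subst s

/-- A set of formulae is a theory of `S` if it contains the theorems of `S` and is closed under
modus ponens. -/
structure IsTheory (S : RuleSystem F) (x : Set F) : Prop where
  theorems_subset : S.theorems ⊆ x
  mp : ∀ {φ ψ : F}, Signature.imp φ ψ ∈ x → φ ∈ x → ψ ∈ x

/-- The positive implicational axioms. -/
structure HasKS (S : RuleSystem F) : Prop where
  k : ∀ φ ψ : F, Signature.imp φ (Signature.imp ψ φ) ∈ S.theorems
  s : ∀ φ ψ χ : F, Signature.imp (Signature.imp φ (Signature.imp ψ χ))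
    (Signature.imp (Signature.imp φ ψ) (Signature.imp φ χ)) ∈ S.theorems

theorem isTheory_theorems (S : RuleSystem F) : IsTheory S S.theorems :=
  ⟨subset_rfl, fun h h' => S.theorems_mp h h'⟩

theorem IsTheory.adjoin {S : RuleSystem F} (hS : HasKS S) {x : Set F} (hx : IsTheory S x)
    (φ : F) : IsTheory S {ψ | Signature.imp φ ψ ∈ x} :=
  ⟨fun ψ hψ => hx.mp (hx.theorems_subset (hS.k ψ φ)) (hx.theorems_subset hψ),
    fun h h' => hx.mp (hx.mp (hx.theorems_subset (hS.s _ _ _)) h) h'⟩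

theorem HasKS.refl {S : RuleSystem F} (hS : HasKS S) (φ : F) :
    Signature.imp φ φ ∈ S.theorems :=
  S.theorems_mp (S.theorems_mp (hS.s φ (Signature.imp φ φ) φ) (hS.k _ _)) (hS.k _ _)

/-- Lindenbaum's lemma: a theory without `φ` extends to one that is maximal without `φ`. -/
theorem IsTheory.exists_maximal {S : RuleSystem F} (hS : HasKS S) {x : Set F} (hx : IsTheory S x)
    {φ : F} (hφ : φ ∉ x) :
    ∃ y, x ⊆ y ∧ IsTheory S y ∧ φ ∉ y ∧ ∀ α ∉ y, Signature.imp α φ ∈ y := by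
  obtain ⟨y, hxy, hy⟩ := zorn_subset_nonempty {y | IsTheory S y ∧ φ ∉ y} (fun c hc hchain hne => by
    refine ⟨⋃₀ c, ⟨⟨?_, ?_⟩, ?_⟩, fun _ => Set.subset_sUnion_of_mem⟩
    · obtain ⟨z, hz⟩ := hne
      exact (hc hz).1.theorems_subset.trans (Set.subset_sUnion_of_mem hz)
    · rintro α β ⟨z, hz, h⟩ ⟨w, hw, h'⟩
      rcases hchain.total hz hw with hzw | hzw
      · exact ⟨w, hw, (hc hw).1.mp (hzw h) h'⟩
      · exact ⟨z, hz, (hc hz).1.mp h (hzw h')⟩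
    · rintro ⟨z, hz, h⟩
      exact (hc hz).2 h) x ⟨hx, hφ⟩
  -- If α → φ were not in y, adjoining α would give a theory containing y and still omitting φ, so
  -- maximality would put α in y.
  refine ⟨y, hxy, hy.prop.1, hy.prop.2, fun α hα => by_contra fun h => hα ?_⟩
  have hsub : y ⊆ {ψ | Signature.imp α ψ ∈ y} := fun ψ hψ =>
    hy.prop.1.mp (hy.prop.1.theorems_subset (hS.k _ _)) hψ
  exact hy.le_of_ge ⟨hy.prop.1.adjoin hS α, h⟩ hsub (hy.prop.1.theorems_subset (hS.refl α))

end Derivations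

/-! ### Kripke semantics of translations -/

section Semantics

variable {W : Type} {R : W → W → Prop} {V : ℕ → W → Prop}

namespace CForm

theorem sat_or {φ ψ : CForm} {w : W} :
    (CForm.or φ ψ).Sat R V w ↔ φ.Sat R V w ∨ ψ.Sat R V w := by
  simp only [CForm.or, Sat]; tauto

theorem sat_imp {φ ψ : CForm} {w : W} :
    (CForm.imp φ ψ).Sat R V w ↔ (φ.Sat R V w → ψ.Sat R V w) := by
  simp only [CForm.imp, Sat]; tauto

theorem sat_boxPlus {φ : CForm} {w : W} :
    (CForm.boxPlus φ).Sat R V w ↔ (∀ v, R w v → φ.Sat R V v) ∧ φ.Sat R V w := Iff.rfl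

theorem sat_subst (b : ℕ → CForm) (φ : CForm) {w : W} :
    (φ.subst b).Sat R V w ↔ φ.Sat R (fun n v => (b n).Sat R V v) w := by
  induction φ generalizing w with
  | var n => exact Iff.rfl
  | bot => exact Iff.rfl
  | top => exact Iff.rfl
  | and φ ψ h₁ h₂ => exact and_congr h₁ h₂
  | neg φ h => exact not_congr h
  | box φ h => exact forall₂_congr fun _ _ => h

/-- Equivalence over transitive frames. -/
def Equiv (φ ψ : CForm) : Prop :=
  ∀ (W : Type) (R : W → W → Prop), (∀ x y z, R x y → R y z → R x z) →
    ∀ (V : ℕ → W → Prop) (w : W), φ.Sat R V w ↔ ψ.Sat R V w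

theorem Equiv.trans {φ ψ χ : CForm} (h : Equiv φ ψ) (h' : Equiv ψ χ) : Equiv φ χ :=
  fun W R hR V w => (h W R hR V w).trans (h' W R hR V w)

theorem Equiv.and {φ ψ φ' ψ' : CForm} (h : Equiv φ φ') (h' : Equiv ψ ψ') :
    Equiv (.and φ ψ) (.and φ' ψ') :=
  fun W R hR V w => and_congr (h W R hR V w) (h' W R hR V w)

theorem Equiv.neg {φ φ' : CForm} (h : Equiv φ φ') : Equiv (.neg φ) (.neg φ') :=
  fun W R hR V w => not_congr (h W R hR V w)

theorem Equiv.or {φ ψ φ' ψ' : CForm} (h : Equiv φ φ') (h' : Equiv ψ ψ') :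
    Equiv (.or φ ψ) (.or φ' ψ') :=
  (h.neg.and h'.neg).neg

theorem Equiv.box {φ φ' : CForm} (h : Equiv φ φ') : Equiv (.box φ) (.box φ') :=
  fun W R hR V _ => forall₂_congr fun v _ => h W R hR V v

theorem Equiv.boxPlus {φ φ' : CForm} (h : Equiv φ φ') : Equiv (.boxPlus φ) (.boxPlus φ') :=
  h.box.and h

end CForm

open CForm

/-- Variables, implications and ⊠ translate to formulae headed by □⁺ or □, which transitivity makes
persistent; ∧ and ∨ keep this. Hence translations behave intuitionistically. -/
theorem sat_T_persistent (hR : ∀ x y z, R x y → R y z → R x z) (φ : IForm) {w v : W}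
    (hwv : R w v) (h : (T φ).Sat R V w) : (T φ).Sat R V v := by
  induction φ generalizing w v with
  | var n => exact ⟨fun u hu => h.1 u (hR _ _ _ hwv hu), h.1 v hwv⟩
  | bot => exact h
  | top => exact h
  | and φ ψ h₁ h₂ => exact ⟨h₁ hwv h.1, h₂ hwv h.2⟩
  | or φ ψ h₁ h₂ => exact sat_or.2 ((sat_or.1 h).imp (h₁ hwv) (h₂ hwv))
  | imp φ ψ => exact ⟨fun u hu => h.1 u (hR _ _ _ hwv hu), h.1 v hwv⟩
  | box φ => exact fun u hu => h u (hR _ _ _ hwv hu)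

theorem sat_T_imp {φ ψ : IForm} {w : W} : (T (.imp φ ψ)).Sat R V w ↔
    (∀ v, R w v → (T φ).Sat R V v → (T ψ).Sat R V v) ∧
      ((T φ).Sat R V w → (T ψ).Sat R V w) := by
  simp only [T, sat_boxPlus, sat_or, Sat, imp_iff_not_or]

theorem boxPlus_T_equiv (φ : IForm) : Equiv (.boxPlus (T φ)) (T φ) :=
  fun _ _ hR _ _ => ⟨And.right, fun h => ⟨fun _ hv => sat_T_persistent hR φ hv h, h⟩⟩

/-- Translations commute with substitutions up to equivalence. -/
theorem T_subst_equiv {b : ℕ → CForm} {s : ℕ → IForm}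
    (h : ∀ n, Equiv (.boxPlus (b n)) (T (s n))) (φ : IForm) :
    Equiv ((T φ).subst b) (T (φ.subst s)) := by
  induction φ with
  | var n => exact h n
  | bot => exact fun _ _ _ _ _ => Iff.rfl
  | top => exact fun _ _ _ _ _ => Iff.rfl
  | and φ ψ h₁ h₂ => exact h₁.and h₂
  | or φ ψ h₁ h₂ => exact h₁.or h₂
  | imp φ ψ h₁ h₂ => exact (h₁.neg.or h₂).boxPlus
  | box φ h => exact h.box

/-- Finite conjunctions of clauses `¬Tα ∨ Tβ`. -/
inductive IsCnf : CForm → Prop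
  | clause (α β : IForm) : IsCnf (.or (.neg (T α)) (T β))
  | and {φ ψ : CForm} : IsCnf φ → IsCnf ψ → IsCnf (.and φ ψ)

/-- A skeletal formula is one equivalent to a Boolean combination of translations. -/
def IsSkeletal (φ : CForm) : Prop := ∃ ψ, IsCnf ψ ∧ Equiv φ ψ

/-! ### Closure properties of skeletal formulae -/

namespace IsSkeletal

theorem congr {φ ψ : CForm} (h : IsSkeletal φ) (e : Equiv ψ φ) : IsSkeletal ψ :=
  let ⟨χ, hχ, e'⟩ := h
  ⟨χ, hχ, e.trans e'⟩

theorem translation (α : IForm) : IsSkeletal (T α) :=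
  ⟨_, .clause .top α, fun _ _ _ _ _ => by simp [sat_or, T, Sat]⟩

theorem and {φ ψ : CForm} (h : IsSkeletal φ) (h' : IsSkeletal ψ) : IsSkeletal (.and φ ψ) :=
  let ⟨_, hφ, e⟩ := h
  let ⟨_, hψ, e'⟩ := h'
  ⟨_, hφ.and hψ, e.and e'⟩

theorem or {φ ψ : CForm} (h : IsSkeletal φ) (h' : IsSkeletal ψ) : IsSkeletal (.or φ ψ) := by
  obtain ⟨φ', hφ, e⟩ := h
  obtain ⟨ψ', hψ, e'⟩ := h'
  refine congr ?_ (e.or e')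
  clear e e'
  induction hφ with
  | clause α β =>
    induction hψ with
    | clause γ δ =>
      -- A disjunction of two clauses is again one clause, because T commutes with ∧ and ∨.
      refine ⟨_, .clause (.and α γ) (.or β δ), fun _ _ _ _ _ => ?_⟩
      simp only [sat_or, Sat, T]
      tauto
    | and _ _ h₁ h₂ =>
      refine (h₁.and h₂).congr fun _ _ _ _ _ => ?_
      simp only [sat_or, Sat]
      tauto
  | and _ _ h₁ h₂ =>
    refine (h₁.and h₂).congr fun _ _ _ _ _ => ?_
    simp only [sat_or, Sat]
    tauto

theorem neg {φ : CForm} (h : IsSkeletal φ) : IsSkeletal (.neg φ) := by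
  obtain ⟨φ', hφ, e⟩ := h
  refine congr ?_ e.neg
  clear e
  induction hφ with
  | clause α β =>
    refine congr (and (translation α) ⟨_, .clause β .bot, fun _ _ _ _ _ => Iff.rfl⟩)
      fun _ _ _ _ _ => ?_
    simp only [sat_or, Sat, T]
    tauto
  | and _ _ h₁ h₂ =>
    refine (h₁.or h₂).congr fun _ _ _ _ _ => ?_
    simp only [sat_or, Sat]
    tauto

/-- □⁺ distributes over the conjunction, and □⁺ of a clause ¬Tα ∨ Tβ is literally T(α → β). This is
the way back from skeletal formulae to translations. -/
theorem exists_boxPlus {φ : CForm} (h : IsSkeletal φ) : ∃ α, Equiv (.boxPlus φ) (T α) := by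
  obtain ⟨φ', hφ, e⟩ := h
  suffices ∃ α, Equiv (.boxPlus φ') (T α) from this.imp fun α h => e.boxPlus.trans h
  clear e
  induction hφ with
  | clause α β => exact ⟨.imp α β, fun _ _ _ _ _ => Iff.rfl⟩
  | and _ _ h₁ h₂ =>
    obtain ⟨α, hα⟩ := h₁
    obtain ⟨β, hβ⟩ := h₂
    refine ⟨.and α β, CForm.Equiv.trans (fun _ _ _ _ _ => ?_) (hα.and hβ)⟩
    simp only [sat_boxPlus, Sat]
    exact ⟨fun h => ⟨⟨fun v hv => (h.1 v hv).1, h.2.1⟩, ⟨fun v hv => (h.1 v hv).2, h.2.2⟩⟩,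
      fun h => ⟨fun v hv => ⟨h.1.1 v hv, h.2.1 v hv⟩, h.1.2, h.2.2⟩⟩

/-- By transitivity □φ is equivalent to □□⁺φ, and so to □Tα = T(⊠α) for a suitable α. -/
theorem box {φ : CForm} (h : IsSkeletal φ) : IsSkeletal (.box φ) := by
  obtain ⟨α, hα⟩ := h.exists_boxPlus
  refine (translation (.box α)).congr (CForm.Equiv.trans (fun _ _ hR _ _ => ?_) hα.box)
  exact ⟨fun h v hv => ⟨fun u hu => h u (hR _ _ _ hv hu), h v hv⟩, fun h v hv => (h v hv).2⟩

theorem subst {b : ℕ → CForm} (hb : ∀ n, IsSkeletal (b n)) (φ : CForm) :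
    IsSkeletal (φ.subst b) := by
  induction φ with
  | var n => exact hb n
  | bot => exact translation .bot
  | top => exact translation .top
  | and φ ψ h₁ h₂ => exact h₁.and h₂
  | neg φ h => exact h.neg
  | box φ h => exact h.box

end IsSkeletal

/-! ### Extensions of K4: deduction theorem and the maps σ and ρ -/

section Extensions

variable {S : RuleSystem CForm}

theorem mem_theorems_of_valid (hS : K4 ≤ S) {φ : CForm} (h : φ.TransitiveValid) :
    φ ∈ S.theorems :=
  RuleSystem.axiomatized_thm_le.1 hS h

theorem mem_theorems_of_imp (hS : K4 ≤ S) {φ ψ : CForm} (h : (CForm.imp φ ψ).TransitiveValid)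
    (hφ : φ ∈ S.theorems) : ψ ∈ S.theorems :=
  S.theorems_mp (mem_theorems_of_valid hS h) hφ

theorem mem_theorems_congr (hS : K4 ≤ S) {φ ψ : CForm} (h : Equiv φ ψ) :
    φ ∈ S.theorems ↔ ψ ∈ S.theorems :=
  ⟨mem_theorems_of_imp hS fun W R hR V w => sat_imp.2 (h W R hR V w).1,
    mem_theorems_of_imp hS fun W R hR V w => sat_imp.2 (h W R hR V w).2⟩

theorem boxPlus_mem_theorems (hS : K4 ≤ S) {φ : CForm} :
    CForm.boxPlus φ ∈ S.theorems ↔ φ ∈ S.theorems := by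
  refine ⟨mem_theorems_of_imp hS fun W R hR V w => sat_imp.2 And.right, fun h => ?_⟩
  refine S.theorems_mp (S.theorems_mp (mem_theorems_of_valid hS ?_) (S.theorems_nec h)) h
  exact fun W R hR V w => sat_imp.2 fun h₁ => sat_imp.2 fun h₂ => ⟨h₁, h₂⟩

theorem hasKS_of_K4_le (hS : K4 ≤ S) : HasKS S where
  k φ ψ := mem_theorems_of_valid hS fun W R hR V w => by
    simp only [Signature.imp, sat_imp]; tauto
  s φ ψ χ := mem_theorems_of_valid hS fun W R hR V w => by
    simp only [Signature.imp, sat_imp]; tauto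

theorem Der.T_mp (hS : K4 ≤ S) {α β : IForm} {Γ : Set CForm}
    (h : Der S.theorems Γ (T (.imp α β))) (hα : Der S.theorems Γ (T α)) :
    Der S.theorems Γ (T β) := by
  refine .mp hα (.mp h (.ax (mem_theorems_of_valid hS ?_)))
  intro W R hR V w
  exact sat_imp.2 fun h => sat_imp.2 (sat_T_imp.1 h).2

/-- The deduction theorem for a translated hypothesis. -/
theorem Der.deduction (hS : K4 ≤ S) {α : IForm} {Γ : Set CForm} {φ : CForm}
    (h : Der S.theorems (insert (T α) Γ) φ) : Der S.theorems Γ (CForm.imp (T α) φ) := by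
  induction h with
  | ax h => exact .mp (.ax h) (.ax ((hasKS_of_K4_le hS).k _ _))
  | hyp h =>
    rcases h with rfl | h
    · exact .ax ((hasKS_of_K4_le hS).refl _)
    · exact .mp (.hyp h) (.ax ((hasKS_of_K4_le hS).k _ _))
  | mp _ _ h₁ h₂ => exact .mp h₁ (.mp h₂ (.ax ((hasKS_of_K4_le hS).s _ _ _)))
  -- Global consequence has no deduction theorem in general; here □(Tα → ψ) → (Tα → □ψ) is valid
  -- because Tα is persistent.
  | @nec ψ _ h =>
    refine .mp (Der.nec h) (.ax (mem_theorems_of_valid hS fun W R hR V w => ?_))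
    refine sat_imp.2 fun h₁ => sat_imp.2 fun h₂ v hv => ?_
    exact sat_imp.1 (h₁ v hv) (sat_T_persistent hR α hv h₂)

/-- Necessitating the classical implication Tα → Tβ supplies the missing □, giving □⁺(¬Tα ∨ Tβ). -/
theorem Der.T_deduction (hS : K4 ≤ S) {α β : IForm} {Γ : Set CForm}
    (h : Der S.theorems (insert (T α) Γ) (T β)) : Der S.theorems Γ (T (.imp α β)) := by
  have h' := Der.deduction hS h
  refine .mp h' (.mp (Der.nec h') (.ax (mem_theorems_of_valid hS fun W R hR V w => ?_)))
  refine sat_imp.2 fun h₁ => sat_imp.2 fun h₂ => sat_T_imp.2 ⟨fun v hv => ?_, sat_imp.1 h₂⟩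
  exact sat_imp.1 (h₁ v hv)

/-- The superintuitionistic formulae whose translations are theorems. -/
def pullback (S : RuleSystem CForm) : Set IForm := {φ | T φ ∈ S.theorems}

theorem pullback_subst (hS : K4 ≤ S) (s : ℕ → IForm) (φ : IForm) (h : φ ∈ pullback S) :
    Signature.subst s φ ∈ pullback S :=
  (mem_theorems_congr hS (T_subst_equiv (fun n => boxPlus_T_equiv (s n)) φ)).1
    (S.theorems_subst (fun n => T (s n)) h)

theorem Der.translation (hS : K4 ≤ S) {Γ : Set IForm} {φ : IForm}
    (h : Der (pullback S) Γ φ) : Der S.theorems (T '' Γ) (T φ) := by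
  induction h with
  | ax h => exact .ax h
  | hyp h => exact .hyp ⟨_, h, rfl⟩
  | mp _ _ h₁ h₂ => exact Der.T_mp hS h₂ h₁
  | nec _ h => exact .nec h

theorem Der.empty {F : Type} [Signature F] [DecidableEq F] {L : RuleSystem F} {φ : F}
    (h : Der L.theorems ∅ φ) : φ ∈ L.theorems := by
  induction h with
  | ax h => exact h
  | hyp h => exact h.elim
  | mp _ _ h₁ h₂ => exact L.theorems_mp h₂ h₁
  | nec _ h => exact L.theorems_nec h

theorem Der.of_translation (hS : K4 ≤ S) (Γ : Finset IForm) {φ : IForm}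
    (h : Der S.theorems (T '' Γ) (T φ)) : Der (pullback S) Γ φ := by
  induction Γ using Finset.induction_on generalizing φ with
  | empty => exact .ax (Der.empty (by simpa using h))
  | insert γ Γ _ ih =>
    rw [Finset.coe_insert, Set.image_insert_eq] at h
    have := ih (Der.T_deduction hS h)
    exact .mp (.hyp (by simp)) (this.trans fun _ hx => .hyp (by simp_all))

/-- `ρM` is the logic axiomatized by the formulae whose translations belong to `M`. -/
theorem rho_eq (hS : K4 ≤ S) (hL : IsLogic S) :
    (axiomatized (thm '' pullback S)).rules = rho S := by
  ext ⟨Γ, Δ⟩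
  rw [mem_axiomatized_thm (pullback_subst hS)]
  refine Iff.trans ?_ (hL.mem_rules_iff (Γ := Γ.image T) (Δ := Δ.image T)).symm
  simp only [Finset.coe_image, Finset.mem_image, exists_exists_and_eq_and]
  exact exists_congr fun δ => and_congr_right fun _ =>
    ⟨Der.translation hS, Der.of_translation hS Γ⟩

theorem theorems_rho (hS : K4 ≤ S) (hL : IsLogic S) :
    (axiomatized (thm '' pullback S)).theorems = pullback S := by
  ext φ
  change thm φ ∈ (axiomatized (thm '' pullback S)).rules ↔ _
  rw [rho_eq hS hL]
  change ((Finset.image T ∅, Finset.image T {φ}) : Rule CForm) ∈ S.rules ↔ _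
  rw [Finset.image_empty, Finset.image_singleton]
  rfl

theorem TRule_mem (hS : K4 ≤ S) {L : RuleSystem IForm} (hL : IsLogic L)
    (h : L.theorems ⊆ pullback S) : TRule '' L.rules ⊆ S.rules := by
  rintro _ ⟨⟨Γ, Δ⟩, hr, rfl⟩
  obtain ⟨δ, hδ, hd⟩ := hL.mem_rules_iff.1 hr
  have hd' : Der (pullback S) Γ δ := by
    clear hr hδ
    induction hd with
    | ax h' => exact .ax (h h')
    | hyp h' => exact .hyp h'
    | mp _ _ h₁ h₂ => exact .mp h₁ h₂
    | nec _ h => exact .nec h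
  refine S.mono (S.mem_of_der subset_rfl (Γ := Γ.image T) ?_) subset_rfl
    (Finset.singleton_subset_iff.2 (Finset.mem_image_of_mem T hδ))
  simpa using Der.translation hS hd'

theorem K4_le_K4Grz : K4 ≤ K4Grz := left_subset_oplus _ _

/-- Derivations in a logic translate step by step, so the translated theorems of L already yield its
translated rules. -/
theorem sigma_le {L : RuleSystem IForm} (hL : IsLogic L) :
    sigma L ≤ S ↔ K4Grz ≤ S ∧ L.theorems ⊆ pullback S := by
  refine oplus_le.trans (and_congr_right fun hS => ?_)
  refine (oplus_le (S := S)).trans ⟨fun h φ hφ => ?_, fun h => ?_⟩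
  · have := h.2 ⟨_, hφ, rfl⟩
    rw [TRule, thm, Finset.image_empty, Finset.image_singleton] at this
    exact this
  · exact ⟨K4_le_K4Grz.trans hS, TRule_mem (K4_le_K4Grz.trans hS) hL h⟩

theorem isLogic_sigma {L : RuleSystem IForm} (hL : IsLogic L) : IsLogic (sigma L) := by
  have h := (sigma_le (S := sigma L) hL).1 le_rfl
  have : sigma L ≤ Taut (sigma L) := by
    refine (sigma_le hL).2 ⟨IsLogic.le_taut Fact.out h.1, fun φ hφ => ?_⟩
    exact subset_axiomatized _ ⟨_, h.2 hφ, rfl⟩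
  rw [le_antisymm this (taut_le _)]
  exact isLogic_taut _

end Extensions

/-! ### Translations of the axioms of mHC and KM -/

section Axioms

theorem T_valid_of_IPC {φ : PForm} (h : IPC φ) : (T φ.toIForm).TransitiveValid := by
  intro W R hR V w
  induction h generalizing w with
  | mp φ ψ _ _ h₁ h₂ => exact (sat_T_imp.1 (h₁ w)).2 (h₂ w)
  | truth => trivial
  | k φ ψ =>
    have hp := fun {w v} => sat_T_persistent (w := w) (v := v) (V := V) hR φ.toIForm
    simp only [PForm.toIForm, sat_T_imp]
    grind
  | s φ ψ χ =>
    simp only [PForm.toIForm, sat_T_imp]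
    grind
  | andIntro φ ψ =>
    have hp := fun {w v} => sat_T_persistent (w := w) (v := v) (V := V) hR φ.toIForm
    simp only [PForm.toIForm, sat_T_imp]
    simp only [T, Sat]
    grind
  | orElim φ ψ χ =>
    simp only [PForm.toIForm, sat_T_imp]
    simp only [T, sat_or]
    grind
  | _ =>
    simp only [PForm.toIForm, sat_T_imp]
    simp only [T, sat_or, Sat]
    tauto

theorem mHC_theorems_subset {S : RuleSystem CForm} (hS : K4 ≤ S) (hL : IsLogic S) :
    mHC.theorems ⊆ pullback S := by
  -- Viewing the pullback as the theorem set of a rule system leaves only the axioms to be checked.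
  rw [← theorems_rho hS hL]
  refine RuleSystem.theorems_mono (RuleSystem.axiomatized_thm_le.2 ?_)
  rw [theorems_rho hS hL]
  rintro _ (⟨φ, hφ, rfl⟩ | rfl | rfl | rfl)
  · exact mem_theorems_of_valid hS (T_valid_of_IPC hφ)
  all_goals
    refine mem_theorems_of_valid hS fun W R hR V w => ?_
    simp only [sat_T_imp]
    simp only [T, sat_boxPlus, sat_or, Sat]
    grind

/-- Take the GL axiom for □⁺p. Where □⁺(□□⁺p → □⁺p) holds, it gives □□⁺p and then □⁺p; the outer □⁺
makes this work at w and at all its successors. -/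
theorem T_KM_of_GL : (CForm.imp (.boxPlus ((CForm.imp
    (.box (CForm.imp (.box (.var 0)) (.var 0))) (.box (.var 0))).subst fun _ => .boxPlus (.var 0)))
    (T (.imp (.imp (.box (.var 0)) (.var 0)) (.var 0)))).TransitiveValid := by
  intro W R hR V w
  simp only [sat_imp, sat_T_imp, sat_boxPlus, sat_subst, Sat]
  simp only [T, sat_boxPlus, Sat]
  grind

/-- If □(□p → p) holds at w, then □□⁺p → □⁺p holds at all successors of w, so the translated KM
axiom yields □⁺p at each of them. -/
theorem GL_of_T_KM : (CForm.imp (T (.imp (.imp (.box (.var 0)) (.var 0)) (.var 0)))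
    (CForm.imp (.box (CForm.imp (.box (.var 0)) (.var 0))) (.box (.var 0)))).TransitiveValid := by
  intro W R hR V w
  simp only [sat_imp, sat_T_imp, Sat]
  simp only [T, sat_boxPlus, Sat]
  grind

/-- By transitivity □p implies □(p → □p), so the Grz premise implies the GL premise. -/
theorem Grz_of_GL : (CForm.imp
    (CForm.imp (.box (CForm.imp (.box (.var 0)) (.var 0))) (.box (.var 0)))
    (CForm.imp (.box (CForm.imp (.box (CForm.imp (.var 0) (.box (.var 0)))) (.var 0)))
      (.box (.var 0)))).TransitiveValid := by
  intro W R hR V w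
  simp only [sat_imp, Sat]
  grind

theorem K4_le_GodelLob : K4 ≤ GodelLob := left_subset_oplus _ _

theorem GodelLob_le_iff {S : RuleSystem CForm} : GodelLob ≤ S ↔ K4 ≤ S ∧
    CForm.imp (.box (CForm.imp (.box (.var 0)) (.var 0))) (.box (.var 0)) ∈ S.theorems :=
  oplus_le.trans (and_congr_right fun _ => by simp [RuleSystem.theorems])

theorem K4Grz_le_iff {S : RuleSystem CForm} : K4Grz ≤ S ↔ K4 ≤ S ∧
    CForm.imp (.box (CForm.imp (.box (CForm.imp (.var 0) (.box (.var 0)))) (.var 0)))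
      (.box (.var 0)) ∈ S.theorems :=
  oplus_le.trans (and_congr_right fun _ => by simp [RuleSystem.theorems])

theorem KM_le_iff {S : RuleSystem IForm} : KM ≤ S ↔ mHC ≤ S ∧
    .imp (.imp (.box (.var 0)) (.var 0)) (.var 0) ∈ S.theorems :=
  oplus_le.trans (and_congr_right fun _ => by simp [RuleSystem.theorems])

theorem mHC_le_KM : mHC ≤ KM := left_subset_oplus _ _

theorem K4Grz_le_GodelLob : K4Grz ≤ GodelLob :=
  K4Grz_le_iff.2 ⟨K4_le_GodelLob, mem_theorems_of_imp K4_le_GodelLob Grz_of_GL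
    (GodelLob_le_iff.1 le_rfl).2⟩

theorem KM_axiom_mem_pullback {S : RuleSystem CForm} (hS : GodelLob ≤ S) :
    .imp (.imp (.box (.var 0)) (.var 0)) (.var 0) ∈ pullback S := by
  have hK := K4_le_GodelLob.trans hS
  exact mem_theorems_of_imp hK T_KM_of_GL ((boxPlus_mem_theorems hK).2
    (S.theorems_subst (fun _ => .boxPlus (.var 0)) (GodelLob_le_iff.1 hS).2))

end Axioms

end Semantics

open CForm

/-! ### The canonical frame of prime theories, and ρσL = L -/

section PrimeTheories

variable {L : RuleSystem IForm}

/-- The substitution of three formulae for the first three variables. -/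
def substThree (α β γ : IForm) : ℕ → IForm
  | 0 => α
  | 1 => β
  | _ => γ

theorem subst_mem_of_IPC (hL : mHC ≤ L) {φ : PForm} (h : IPC φ) (α β γ : IForm) :
    φ.toIForm.subst (substThree α β γ) ∈ L.theorems :=
  L.theorems_subst _ (RuleSystem.axiomatized_thm_le.1 hL (.inl ⟨φ, h, rfl⟩))

theorem subst_mem_of_mHCAxioms (hL : mHC ≤ L) {φ : IForm} (h : φ ∈ mHCAxioms) (α β : IForm) :
    φ.subst (substThree α β β) ∈ L.theorems :=
  L.theorems_subst _ (RuleSystem.axiomatized_thm_le.1 hL (.inr h))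

theorem hasKS_of_mHC_le (hL : mHC ≤ L) : HasKS L where
  k α β := subst_mem_of_IPC hL (.k (.var 0) (.var 1)) α β β
  s α β γ := subst_mem_of_IPC hL (.s (.var 0) (.var 1) (.var 2)) α β γ

namespace IsTheory

variable {x : Set IForm}

theorem and_mem_iff (hL : mHC ≤ L) (hx : IsTheory L x) {α β : IForm} :
    .and α β ∈ x ↔ α ∈ x ∧ β ∈ x :=
  ⟨fun h => ⟨hx.mp (hx.theorems_subset
      (subst_mem_of_IPC hL (.andLeft (.var 0) (.var 1)) α β β)) h,
    hx.mp (hx.theorems_subset (subst_mem_of_IPC hL (.andRight (.var 0) (.var 1)) α β β)) h⟩,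
  fun h => hx.mp (hx.mp (hx.theorems_subset
    (subst_mem_of_IPC hL (.andIntro (.var 0) (.var 1)) α β β)) h.1) h.2⟩

theorem or_mem (hL : mHC ≤ L) (hx : IsTheory L x) {α β : IForm} (h : α ∈ x ∨ β ∈ x) :
    .or α β ∈ x :=
  h.elim (hx.mp (hx.theorems_subset (subst_mem_of_IPC hL (.orLeft (.var 0) (.var 1)) α β β)))
    (hx.mp (hx.theorems_subset (subst_mem_of_IPC hL (.orRight (.var 0) (.var 1)) α β β)))

theorem or_elim (hL : mHC ≤ L) (hx : IsTheory L x) {α β γ : IForm} (h : .or α β ∈ x)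
    (h₁ : .imp α γ ∈ x) (h₂ : .imp β γ ∈ x) : γ ∈ x :=
  hx.mp (hx.mp (hx.mp (hx.theorems_subset
    (subst_mem_of_IPC hL (.orElim (.var 0) (.var 1) (.var 2)) α β γ)) h₁) h₂) h

theorem mem_of_bot (hL : mHC ≤ L) (hx : IsTheory L x) {α : IForm} (h : .bot ∈ x) : α ∈ x :=
  hx.mp (hx.theorems_subset (subst_mem_of_IPC hL (.exFalso (.var 0)) α α α)) h

theorem top_mem (hL : mHC ≤ L) (hx : IsTheory L x) : .top ∈ x :=
  hx.theorems_subset (subst_mem_of_IPC hL .truth .top .top .top)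

theorem box_mem (hL : mHC ≤ L) (hx : IsTheory L x) {α : IForm} (h : α ∈ x) : .box α ∈ x :=
  hx.mp (hx.theorems_subset
    (subst_mem_of_mHCAxioms hL (φ := .imp (.var 0) (.box (.var 0))) (by simp [mHCAxioms]) α α)) h

theorem box_mp (hL : mHC ≤ L) (hx : IsTheory L x) {α β : IForm} (h : .box (.imp α β) ∈ x)
    (hα : .box α ∈ x) : .box β ∈ x :=
  hx.mp (hx.mp (hx.theorems_subset (subst_mem_of_mHCAxioms hL
    (φ := .imp (.box (.imp (.var 0) (.var 1))) (.imp (.box (.var 0)) (.box (.var 1))))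
    (by simp [mHCAxioms]) α β)) h) hα

theorem box_density (hL : mHC ≤ L) (hx : IsTheory L x) {α : IForm} (h : .box α ∈ x) (β : IForm) :
    .or β (.imp β α) ∈ x :=
  hx.mp (hx.theorems_subset (subst_mem_of_mHCAxioms hL
    (φ := .imp (.box (.var 0)) (.or (.var 1) (.imp (.var 1) (.var 0))))
    (by simp [mHCAxioms]) α β)) h

end IsTheory

/-- Prime theories of a superintuitionistic modal logic. -/
structure IsPrime (L : RuleSystem IForm) (x : Set IForm) : Prop where
  isTheory : IsTheory L x
  bot_notMem : .bot ∉ x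
  prime : ∀ {α β : IForm}, .or α β ∈ x → α ∈ x ∨ β ∈ x

/-- The points of the canonical frame of a superintuitionistic modal logic. -/
abbrev PrimeTheory (L : RuleSystem IForm) : Type := {x : Set IForm // IsPrime L x}

/-- The accessibility relation of the canonical frame. -/
def PrimeTheory.Rel (x y : PrimeTheory L) : Prop := ∀ α, .box α ∈ x.1 → α ∈ y.1

/-- The canonical valuation. -/
def PrimeTheory.val (n : ℕ) (x : PrimeTheory L) : Prop := .var n ∈ x.1

theorem IsTheory.exists_prime (hL : mHC ≤ L) {x : Set IForm} (hx : IsTheory L x) {φ : IForm}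
    (hφ : φ ∉ x) : ∃ y : PrimeTheory L, x ⊆ y.1 ∧ φ ∉ y.1 := by
  obtain ⟨y, hxy, hy, hφy, hmax⟩ := hx.exists_maximal (hasKS_of_mHC_le hL) hφ
  refine ⟨⟨y, hy, fun h => hφy (hy.mem_of_bot hL h), fun h => ?_⟩, hxy, hφy⟩
  by_contra! hn
  exact hφy (hy.or_elim hL h (hmax _ hn.1) (hmax _ hn.2))

namespace PrimeTheory

theorem Rel.subset (hL : mHC ≤ L) {x y : PrimeTheory L} (h : x.Rel y) : x.1 ⊆ y.1 :=
  fun _ hα => h _ (x.2.isTheory.box_mem hL hα)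

theorem Rel.trans (hL : mHC ≤ L) {x y z : PrimeTheory L} (h : x.Rel y) (h' : y.Rel z) :
    x.Rel z :=
  fun α hα => h'.subset hL (h α hα)

theorem rel_transitive (hL : mHC ≤ L) (x y z : PrimeTheory L) (h : x.Rel y) (h' : y.Rel z) :
    x.Rel z :=
  h.trans hL h'

/-- Choose β in y but not in x. If ⊠α ∈ x, primeness of x applied to β ∨ (β → α) puts β → α in x,
hence α in y. -/
theorem rel_of_subset (hL : mHC ≤ L) {x y : PrimeTheory L} (h : x.1 ⊆ y.1) (hne : x ≠ y) :
    x.Rel y := by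
  obtain ⟨β, hy, hx⟩ := Set.not_subset.1 fun h' => hne (Subtype.ext (h.antisymm h'))
  intro α hα
  rcases x.2.prime (x.2.isTheory.box_density hL hα β) with h' | h'
  · exact (hx h').elim
  · exact y.2.isTheory.mp (h h') hy

theorem sat_T_iff (hL : mHC ≤ L) (φ : IForm) (x : PrimeTheory L) :
    (T φ).Sat Rel val x ↔ φ ∈ x.1 := by
  induction φ generalizing x with
  | var n => exact ⟨And.right, fun h => ⟨fun y hy => hy.subset hL h, h⟩⟩
  | bot => exact ⟨False.elim, x.2.bot_notMem⟩
  | top => exact ⟨fun _ => x.2.isTheory.top_mem hL, fun _ => trivial⟩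
  | and φ ψ h₁ h₂ => exact (and_congr (h₁ x) (h₂ x)).trans (x.2.isTheory.and_mem_iff hL).symm
  | or φ ψ h₁ h₂ =>
    exact (sat_or.trans (or_congr (h₁ x) (h₂ x))).trans ⟨x.2.isTheory.or_mem hL, x.2.prime⟩
  | imp φ ψ h₁ h₂ =>
    simp only [sat_T_imp, h₁, h₂]
    refine ⟨fun ⟨h, hx⟩ => ?_, fun h => ⟨fun y hy => y.2.isTheory.mp (hy.subset hL h),
      x.2.isTheory.mp h⟩⟩
    by_contra hn
    obtain ⟨y, hxy, hy⟩ := (x.2.isTheory.adjoin (hasKS_of_mHC_le hL) φ).exists_prime hL hn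
    have hφ : φ ∈ y.1 := hxy (x.2.isTheory.theorems_subset ((hasKS_of_mHC_le hL).refl φ))
    have hsub : x.1 ⊆ y.1 := fun α hα =>
      hxy (x.2.isTheory.mp (x.2.isTheory.theorems_subset ((hasKS_of_mHC_le hL).k α φ)) hα)
    -- The extension refuting φ → ψ is either x itself or a proper extension, hence a successor: the
    -- two conjuncts of □⁺.
    by_cases e : x = y
    · exact hy (e ▸ hx (e ▸ hφ))
    · exact hy (h y (rel_of_subset hL hsub e) hφ)
  | box φ h =>
    simp only [T, Sat, h]
    refine ⟨fun h => ?_, fun h y hy => hy _ h⟩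
    by_contra hn
    obtain ⟨y, hxy, hy⟩ := IsTheory.exists_prime hL (x := {α | IForm.box α ∈ x.1})
      ⟨fun α hα => x.2.isTheory.theorems_subset (L.theorems_nec hα), fun h h' => x.2.isTheory.box_mp hL h h'⟩ hn
    exact hy (h y fun α hα => hxy hα)

theorem isPrime_sUnion {c : Set (PrimeTheory L)} (hc : IsChain (· ≤ ·) c) (hne : c.Nonempty) :
    IsPrime L (⋃ y ∈ c, y.1) where
  isTheory := by
    refine ⟨?_, fun {α β} h h' => ?_⟩
    · obtain ⟨y, hy⟩ := hne
      exact y.2.isTheory.theorems_subset.trans (Set.subset_biUnion_of_mem (u := (·.1)) hy)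
    · obtain ⟨y, hy, h⟩ := Set.mem_iUnion₂.1 h
      obtain ⟨z, hz, h'⟩ := Set.mem_iUnion₂.1 h'
      rcases hc.total hy hz with e | e
      · exact Set.mem_biUnion hz (z.2.isTheory.mp (e h) h')
      · exact Set.mem_biUnion hy (y.2.isTheory.mp h (e h'))
  bot_notMem h := by
    obtain ⟨y, hy, h⟩ := Set.mem_iUnion₂.1 h
    exact y.2.bot_notMem h
  prime h := by
    obtain ⟨y, hy, h⟩ := Set.mem_iUnion₂.1 h
    exact (y.2.prime h).imp (Set.mem_biUnion hy) (Set.mem_biUnion hy)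

/-- Along a chain, the truth value of a conjunction of clauses is eventually that at the union. -/
theorem eventually_sat_iff (hL : mHC ≤ L) {c : Set (PrimeTheory L)} (hc : IsChain (· ≤ ·) c)
    (hne : c.Nonempty) {χ : CForm} (hχ : IsCnf χ) : ∃ y ∈ c, ∀ z ∈ c, y ≤ z →
      (χ.Sat Rel val z ↔ χ.Sat Rel val (⟨_, isPrime_sUnion hc hne⟩ : PrimeTheory L)) := by
  have key {p q : PrimeTheory L → Prop} (hp : ∃ y ∈ c, ∀ z ∈ c, y ≤ z → p z)
      (hq : ∃ y ∈ c, ∀ z ∈ c, y ≤ z → q z) : ∃ y ∈ c, ∀ z ∈ c, y ≤ z → p z ∧ q z := by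
    obtain ⟨y, hy, h⟩ := hp
    obtain ⟨y', hy', h'⟩ := hq
    rcases hc.total hy hy' with e | e
    · exact ⟨y', hy', fun z hz hyz => ⟨h z hz (e.trans hyz), h' z hz hyz⟩⟩
    · exact ⟨y, hy, fun z hz hyz => ⟨h z hz hyz, h' z hz (e.trans hyz)⟩⟩
  have atom (α : IForm) : ∃ y ∈ c, ∀ z ∈ c, y ≤ z →
      ((T α).Sat Rel val z ↔
        (T α).Sat Rel val (⟨_, isPrime_sUnion hc hne⟩ : PrimeTheory L)) := by
    simp only [sat_T_iff hL, Set.mem_iUnion₂]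
    by_cases h : ∃ y, ∃ _ : y ∈ c, α ∈ y.1
    · obtain ⟨y, hy, hα⟩ := h
      exact ⟨y, hy, fun z hz hyz => iff_of_true (hyz hα) ⟨y, hy, hα⟩⟩
    · obtain ⟨y, hy⟩ := hne
      exact ⟨y, hy, fun z hz _ => iff_of_false (fun hα => h ⟨z, hz, hα⟩) h⟩
  induction hχ with
  | clause α β =>
    obtain ⟨y, hy, h⟩ := key (atom α) (atom β)
    refine ⟨y, hy, fun z hz hyz => ?_⟩
    rw [sat_or, sat_or]
    exact or_congr (not_congr (h z hz hyz).1) (h z hz hyz).2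
  | and _ _ h₁ h₂ =>
    obtain ⟨y, hy, h⟩ := key h₁ h₂
    exact ⟨y, hy, fun z hz hyz => and_congr (h z hz hyz).1 (h z hz hyz).2⟩

/-- A point refuting a skeletal formula lies below a maximal such point. -/
theorem exists_maximal_not_sat (hL : mHC ≤ L) {χ : CForm} (hχ : IsSkeletal χ)
    {x : PrimeTheory L} (hx : ¬ χ.Sat Rel val x) :
    ∃ y, x ≤ y ∧ Maximal (fun z : PrimeTheory L => ¬ χ.Sat Rel val z) y := by
  obtain ⟨χ', hχ', e⟩ := hχ
  have e' (z : PrimeTheory L) : χ.Sat Rel val z ↔ χ'.Sat Rel val z :=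
    e _ _ (rel_transitive hL) _ z
  refine zorn_le_nonempty₀ {z : PrimeTheory L | ¬ χ.Sat Rel val z} (fun c hcs hc z hz => ?_) x hx
  refine ⟨⟨_, isPrime_sUnion hc ⟨z, hz⟩⟩, ?_, fun y hy => Set.subset_biUnion_of_mem (u := (·.1)) hy⟩
  obtain ⟨y, hy, h⟩ := eventually_sat_iff hL hc ⟨z, hz⟩ hχ'
  exact fun hs => hcs hy ((e' _).2 ((h y hy le_rfl).2 ((e' _).1 hs)))

/-- The rules that are valid in the canonical frame with respect to skeletal valuations. -/
def skeletalRules (L : RuleSystem IForm) : Set (Rule CForm) :=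
  {r | ∀ b : ℕ → CForm, (∀ n, IsSkeletal (b n)) →
    (∀ γ ∈ r.1, ∀ x : PrimeTheory L, (γ.subst b).Sat Rel val x) →
    ∃ δ ∈ r.2, ∀ x : PrimeTheory L, (δ.subst b).Sat Rel val x}

/-- Structurality is the reason for admitting all skeletal valuations: a substitution followed by a
skeletal one is again skeletal. -/
theorem isRuleSystem_skeletalRules : IsRuleSystem (skeletalRules L) where
  structurality s Γ Δ h b hb hΓ := by
    obtain ⟨δ, hδ, h'⟩ := h (fun n => (s n).subst b) (fun n => IsSkeletal.subst hb _)
      fun γ hγ x => by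
        have := hΓ _ (Finset.mem_image_of_mem _ hγ) x
        change ((γ.subst s).subst b).Sat _ _ x at this
        simpa only [sat_subst] using this
    refine ⟨_, Finset.mem_image_of_mem _ hδ, fun x => ?_⟩
    change ((δ.subst s).subst b).Sat _ _ x
    simpa only [sat_subst] using h' x
  reflexivity φ b _ h := ⟨φ, by simp, h φ (by simp)⟩
  monotonicity Γ Δ Γ' Δ' h b hb hΓ := by
    obtain ⟨δ, hδ, h'⟩ := h b hb fun γ hγ => hΓ γ (Finset.mem_union_left _ hγ)
    exact ⟨δ, Finset.mem_union_left _ hδ, h'⟩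
  cut Γ Δ φ h₁ h₂ b hb hΓ := by
    obtain ⟨δ, hδ, h⟩ := h₁ b hb hΓ
    rcases Finset.mem_insert.1 hδ with rfl | hδ
    · refine h₂ b hb fun γ hγ => ?_
      rcases Finset.mem_insert.1 hγ with rfl | hγ
      exacts [h, hΓ γ hγ]
    · exact ⟨δ, hδ, h⟩
  modusPonens φ ψ b _ h := ⟨ψ, by simp, fun x =>
    sat_imp.1 (h (CForm.imp φ ψ) (Finset.mem_insert_of_mem (Finset.mem_singleton_self _)) x)
      (h φ (by simp) x)⟩
  necessitation φ b _ h := ⟨.box φ, Finset.mem_singleton_self _, fun _ y _ => h φ (by simp) y⟩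

theorem mem_theorems_skeletalRules {φ : CForm} :
    φ ∈ RuleSystem.theorems (⟨skeletalRules L, isRuleSystem_skeletalRules⟩ : RuleSystem CForm) ↔
      ∀ b : ℕ → CForm, (∀ n, IsSkeletal (b n)) → ∀ x : PrimeTheory L,
        (φ.subst b).Sat Rel val x := by
  refine forall₂_congr fun b _ => ?_
  simp [thm]

/-- Above a successor of x refuting χ take a maximal refuting point m. If m sees z with χ, and z
sees w without χ, then m ⊆ z ⊆ w forces w = m and z = m, which is absurd. So □(χ → □χ) holds at m,
and the premise gives χ there. -/
theorem sat_Grz (hL : mHC ≤ L) {χ : CForm} (hχ : IsSkeletal χ) (x : PrimeTheory L) :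
    (CForm.imp (.box (CForm.imp (.box (CForm.imp χ (.box χ))) χ)) (.box χ)).Sat Rel val x := by
  simp only [sat_imp, Sat]
  intro h y hxy
  by_contra hy
  obtain ⟨m, hym, hm⟩ := exists_maximal_not_sat hL hχ hy
  have hxm : x.Rel m := fun α hα => hym (hxy α hα)
  refine hm.prop (h m hxm fun z hmz hz w hzw => ?_)
  by_contra hw
  have hmw : m ≤ w := (hmz.trans hL hzw).subset hL
  have hwm : w = m := le_antisymm (hm.le_of_ge hw hmw) hmw
  have : z = m := le_antisymm (hwm ▸ hzw.subset hL) (hmz.subset hL)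
  exact hm.prop (this ▸ hz)

theorem sigma_le_skeletalRules (hL : mHC ≤ L) (hL' : IsLogic L) :
    sigma L ≤ ⟨skeletalRules L, isRuleSystem_skeletalRules⟩ := by
  refine (sigma_le hL').2 ⟨K4Grz_le_iff.2 ⟨RuleSystem.axiomatized_thm_le.2 fun φ hφ => ?_, ?_⟩,
    fun φ hφ => ?_⟩
  · refine mem_theorems_skeletalRules.2 fun b _ x => ?_
    rw [sat_subst]
    exact hφ _ _ (rel_transitive hL) _ x
  · exact mem_theorems_skeletalRules.2 fun b hb x => sat_Grz hL (hb 0) x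
  · refine mem_theorems_skeletalRules.2 fun b hb x => ?_
    choose s hs using fun n => (hb n).exists_boxPlus
    rw [T_subst_equiv hs φ _ _ (rel_transitive hL) _ x, sat_T_iff hL]
    exact x.2.isTheory.theorems_subset (L.theorems_subst s hφ)

end PrimeTheory

/-- A prime theory omitting φ refutes Tφ, while every theorem of σL holds there under skeletal
valuations. -/
theorem pullback_sigma {L : RuleSystem IForm} (hL : mHC ≤ L) (hL' : IsLogic L) :
    pullback (sigma L) = L.theorems := by
  refine subset_antisymm (fun φ hφ => ?_) ((sigma_le hL').1 le_rfl).2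
  by_contra hn
  obtain ⟨x, -, hx⟩ := (isTheory_theorems L).exists_prime hL hn
  refine hx ((PrimeTheory.sat_T_iff hL φ x).1 ?_)
  have h := PrimeTheory.mem_theorems_skeletalRules.1
    (PrimeTheory.sigma_le_skeletalRules hL hL' hφ) (fun n => T (.var n))
    (fun n => .translation _) x
  -- Variables themselves need not be skeletal, but replacing each p by □⁺p does not change Tφ, as
  -- □⁺ is idempotent.
  have e := T_subst_equiv (b := fun n => T (.var n)) (s := .var) (fun n => boxPlus_T_equiv _) φ
  rw [e _ _ (PrimeTheory.rel_transitive hL)] at h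
  have hφ' : φ.subst .var = φ := by
    clear hφ hn hx h e
    induction φ <;> simp_all [IForm.subst]
  rwa [hφ'] at h

end PrimeTheories

/-! ### The canonical frame of maximal consistent sets, and σρM = M -/

section Worlds

variable {S : RuleSystem CForm}

namespace IsTheory

variable {x : Set CForm}

theorem mem_of_valid (hS : K4 ≤ S) (hx : IsTheory S x) {φ : CForm} (h : φ.TransitiveValid) :
    φ ∈ x :=
  hx.theorems_subset (mem_theorems_of_valid hS h)

theorem mem_of_imp (hS : K4 ≤ S) (hx : IsTheory S x) {φ ψ : CForm}
    (h : (CForm.imp φ ψ).TransitiveValid) (hφ : φ ∈ x) : ψ ∈ x :=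
  hx.mp (hx.mem_of_valid hS h) hφ

theorem mem_of_imp_imp (hS : K4 ≤ S) (hx : IsTheory S x) {φ ψ χ : CForm}
    (h : (CForm.imp φ (CForm.imp ψ χ)).TransitiveValid) (hφ : φ ∈ x) (hψ : ψ ∈ x) : χ ∈ x :=
  hx.mp (hx.mem_of_imp hS h hφ) hψ

end IsTheory

/-- Maximal consistent sets of an extension of `K4`. -/
structure IsMaxCons (S : RuleSystem CForm) (x : Set CForm) : Prop where
  isTheory : IsTheory S x
  neg_mem_iff : ∀ φ, .neg φ ∈ x ↔ φ ∉ x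

/-- The points of the canonical frame of an extension of `K4`. -/
abbrev World (S : RuleSystem CForm) : Type := {x : Set CForm // IsMaxCons S x}

theorem IsTheory.exists_world (hS : K4 ≤ S) {x : Set CForm} (hx : IsTheory S x) {φ : CForm}
    (hφ : φ ∉ x) : ∃ y : World S, x ⊆ y.1 ∧ φ ∉ y.1 := by
  obtain ⟨y, hxy, hy, hφy, hmax⟩ := hx.exists_maximal (hasKS_of_K4_le hS) hφ
  refine ⟨⟨y, hy, fun α => ⟨fun h h' => hφy ?_, fun h => by_contra fun h' => hφy ?_⟩⟩, hxy, hφy⟩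
  · refine hy.mem_of_imp_imp hS (fun W R hR V w => ?_) h h'
    simp only [sat_imp, Sat]
    tauto
  · refine hy.mem_of_imp_imp hS (fun W R hR V w => ?_) (hmax _ h) (hmax _ h')
    simp only [Signature.imp, sat_imp, Sat]
    tauto

namespace World

/-- The accessibility relation of the canonical frame. -/
def Rel (x y : World S) : Prop := ∀ φ, .box φ ∈ x.1 → φ ∈ y.1

/-- The canonical valuation. -/
def val (n : ℕ) (x : World S) : Prop := .var n ∈ x.1

theorem box_box_mem (hS : K4 ≤ S) {x : World S} {φ : CForm} (h : .box φ ∈ x.1) :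
    .box (.box φ) ∈ x.1 :=
  x.2.isTheory.mem_of_imp hS (fun _ _ hR _ _ => sat_imp.2 fun (h : Sat _ _ (.box φ) _) _ hv _ hu =>
    h _ (hR _ _ _ hv hu)) h

theorem rel_transitive (hS : K4 ≤ S) (x y z : World S) (h : x.Rel y) (h' : y.Rel z) : x.Rel z :=
  fun _ hφ => h' _ (h _ (box_box_mem hS hφ))

theorem and_mem_iff (hS : K4 ≤ S) {x : World S} {φ ψ : CForm} :
    .and φ ψ ∈ x.1 ↔ φ ∈ x.1 ∧ ψ ∈ x.1 :=
  ⟨fun h => ⟨x.2.isTheory.mem_of_imp hS (fun _ _ _ _ _ => sat_imp.2 And.left) h,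
    x.2.isTheory.mem_of_imp hS (fun _ _ _ _ _ => sat_imp.2 And.right) h⟩,
  fun h => x.2.isTheory.mem_of_imp_imp hS
    (fun _ _ _ _ _ => sat_imp.2 fun h => sat_imp.2 fun h' => ⟨h, h'⟩) h.1 h.2⟩

theorem top_mem (hS : K4 ≤ S) (x : World S) : .top ∈ x.1 :=
  x.2.isTheory.mem_of_valid hS fun _ _ _ _ _ => trivial

theorem bot_notMem (hS : K4 ≤ S) (x : World S) : .bot ∉ x.1 :=
  (x.2.neg_mem_iff _).1 (x.2.isTheory.mem_of_valid hS fun _ _ _ _ _ => id)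

theorem exists_rel (hS : K4 ≤ S) {x : World S} {φ : CForm} (h : .box φ ∉ x.1) :
    ∃ y, x.Rel y ∧ φ ∉ y.1 := by
  have hx : IsTheory S {ψ | CForm.box ψ ∈ x.1} :=
    ⟨fun ψ hψ => x.2.isTheory.theorems_subset (S.theorems_nec hψ), fun h₁ h₂ =>
      x.2.isTheory.mem_of_imp_imp hS (φ := .box (CForm.imp _ _)) (ψ := .box _) (χ := .box _)
        (fun _ _ _ _ _ => sat_imp.2 fun h₁ => sat_imp.2
          fun h₂ v hv => sat_imp.1 (h₁ v hv) (h₂ v hv)) h₁ h₂⟩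
  exact hx.exists_world hS h

theorem sat_iff (hS : K4 ≤ S) (φ : CForm) (x : World S) : φ.Sat Rel val x ↔ φ ∈ x.1 := by
  induction φ generalizing x with
  | var n => exact Iff.rfl
  | bot => exact ⟨False.elim, x.bot_notMem hS⟩
  | top => exact ⟨fun _ => x.top_mem hS, fun _ => trivial⟩
  | and φ ψ h₁ h₂ => exact (and_congr (h₁ x) (h₂ x)).trans (and_mem_iff hS).symm
  | neg φ h => exact (not_congr (h x)).trans (x.2.neg_mem_iff φ).symm
  | box φ h =>
    simp only [Sat, h]
    refine ⟨fun h => by_contra fun hn => ?_, fun h y hy => hy _ h⟩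
    obtain ⟨y, hy, hn⟩ := exists_rel hS hn
    exact hn (h y hy)

theorem boxPlus_mem_iff (hS : K4 ≤ S) {x : World S} {φ : CForm} :
    .boxPlus φ ∈ x.1 ↔ .box φ ∈ x.1 ∧ φ ∈ x.1 :=
  and_mem_iff hS

/-- A point of `χ` is passive if `χ` cannot be left and entered again. -/
def Passive (χ : CForm) (x : World S) : Prop :=
  χ ∈ x.1 ∧ ∀ y, x.Rel y → χ ∉ y.1 → ∀ z, y.Rel z → χ ∉ z.1

/-- If χ failed at x, the first condition would give □⁺¬χ, against the second. What matters is the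
form: a Boolean combination of □⁺-formulae, hence a skeletal condition. -/
theorem passive_iff (hS : K4 ≤ S) {χ : CForm} {x : World S} : Passive χ x ↔
    .boxPlus (CForm.imp (.neg χ) (.box (.neg χ))) ∈ x.1 ∧ .boxPlus (.neg χ) ∉ x.1 := by
  simp only [← sat_iff hS, Passive, sat_boxPlus, sat_imp, Sat]
  grind

/-- The Grz axiom for ¬χ, contraposed: if x sees χ, it sees a point with χ and □(¬χ → □¬χ). -/
theorem exists_passive (hS : K4Grz ≤ S) {χ : CForm} {x y : World S} (hxy : x.Rel y)
    (hy : χ ∈ y.1) : ∃ z, x.Rel z ∧ Passive χ z := by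
  have hK := K4_le_K4Grz.trans hS
  have h := x.2.isTheory.theorems_subset
    (S.theorems_subst (fun _ => .neg χ) (K4Grz_le_iff.1 hS).2)
  have h' := (sat_iff hK _ x).2 h
  simp only [Signature.subst, sat_subst, sat_imp, Sat] at h'
  simp only [sat_iff hK] at h'
  by_contra! hn
  refine h' (fun z hxz hz hχ => hn z hxz ⟨hχ, hz⟩) y hxy hy

end World

/-- A set determined by membership in finitely many members of a set algebra belongs to it. -/
theorem mem_of_determined {X : Type} {D : Set (Set X)} (huniv : Set.univ ∈ D)
    (hcompl : ∀ U ∈ D, Uᶜ ∈ D) (hinter : ∀ U ∈ D, ∀ U' ∈ D, U ∩ U' ∈ D) {I : Set (Set X)}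
    (hfin : I.Finite) (hI : I ⊆ D) (U : Set X)
    (hU : ∀ x y, (∀ A ∈ I, x ∈ A ↔ y ∈ A) → x ∈ U → y ∈ U) : U ∈ D := by
  induction I, hfin using Set.Finite.induction_on generalizing U with
  | empty =>
    rcases U.eq_empty_or_nonempty with rfl | ⟨x, hx⟩
    · simpa using hcompl _ huniv
    · rwa [Set.eq_univ_of_forall fun y => hU x y (by simp) hx]
  | @insert A I _ _ ih =>
    have hA : A ∈ D := hI (Set.mem_insert _ _)
    have key (B : Set X) (hB : ∀ x y, (∀ C ∈ I, x ∈ C ↔ y ∈ C) → x ∈ B → y ∈ B) : B ∈ D :=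
      ih (fun _ h => hI (Set.mem_insert_of_mem _ h)) B hB
    -- The saturation of B ∩ U under agreement on the remaining sets; U is recovered from it
    -- separately on A and on its complement.
    let f (B : Set X) : Set X := {x | ∃ y ∈ B ∩ U, ∀ C ∈ I, y ∈ C ↔ x ∈ C}
    have hf (B : Set X) : f B ∈ D := key _ fun x y h ⟨z, hz, h'⟩ =>
      ⟨z, hz, fun C hC => (h' C hC).trans (h C hC)⟩
    have e : U = ((A ∩ f A)ᶜ ∩ (Aᶜ ∩ f Aᶜ)ᶜ)ᶜ := by
      ext x
      rw [Set.compl_inter, compl_compl, compl_compl]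
      constructor
      · intro hx
        by_cases hxA : x ∈ A
        · exact .inl ⟨hxA, x, ⟨hxA, hx⟩, fun _ _ => Iff.rfl⟩
        · exact .inr ⟨hxA, x, ⟨hxA, hx⟩, fun _ _ => Iff.rfl⟩
      · rintro (⟨hxA, y, ⟨hyA, hy⟩, h⟩ | ⟨hxA, y, ⟨hyA, hy⟩, h⟩) <;> refine hU y x ?_ hy
        · exact Set.forall_mem_insert.2 ⟨iff_of_true hyA hxA, h⟩
        · exact Set.forall_mem_insert.2 ⟨iff_of_false hyA hxA, h⟩
    rw [e]
    exact hcompl _ (hinter _ (hcompl _ (hinter _ hA _ (hf _))) _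
      (hcompl _ (hinter _ (hcompl _ hA) _ (hf _))))

/-- A numbering of the classical modal formulae. -/
def CForm.code : CForm → ℕ
  | .var n => Nat.pair 0 n
  | .bot => Nat.pair 1 0
  | .top => Nat.pair 2 0
  | .and φ ψ => Nat.pair 3 (Nat.pair φ.code ψ.code)
  | .neg φ => Nat.pair 4 φ.code
  | .box φ => Nat.pair 5 φ.code

theorem CForm.code_injective : Function.Injective CForm.code := by
  intro φ
  induction φ with
  | and α β h₁ h₂ =>
    rintro (_ | _ | _ | ⟨γ, δ⟩ | _ | _) h <;> simp only [CForm.code, Nat.pair_eq_pair] at h <;>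
      try omega
    rw [h₁ h.2.1, h₂ h.2.2]
  | neg α h' | box α h' =>
    rintro (_ | _ | _ | _ | γ | γ) h <;> simp only [CForm.code, Nat.pair_eq_pair] at h <;>
      try omega
    rw [h' h.2]
  | _ => rintro (_ | _ | _ | _ | _ | _) h <;> simp_all [CForm.code, Nat.pair_eq_pair]

instance : Countable CForm := CForm.code_injective.countable

instance : Nonempty CForm := ⟨.bot⟩

/-- The set of subformulae. -/
def CForm.sub : CForm → Finset CForm
  | .var n => {.var n}
  | .bot => {.bot}
  | .top => {.top}
  | .and φ ψ => insert (.and φ ψ) (φ.sub ∪ ψ.sub)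
  | .neg φ => insert (.neg φ) φ.sub
  | .box φ => insert (.box φ) φ.sub

theorem CForm.mem_sub_self (φ : CForm) : φ ∈ φ.sub := by
  cases φ <;> simp [CForm.sub]

namespace World

/-- The sets of points defined by a substitution instance of a skeletal formula. -/
def skeletalSets (S : RuleSystem CForm) (s : ℕ → CForm) : Set (Set (World S)) :=
  {U | ∃ b, IsSkeletal b ∧ ∀ x : World S, x ∈ U ↔ b.subst s ∈ x.1}

/-- The sets of points defined by a formula. -/
def definableSets (S : RuleSystem CForm) : Set (Set (World S)) :=
  {U | ∃ b, ∀ x : World S, x ∈ U ↔ b ∈ x.1}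

section SkeletalSets

variable {s : ℕ → CForm}

theorem univ_mem_skeletalSets (hS : K4 ≤ S) : Set.univ ∈ skeletalSets S s :=
  ⟨_, .translation .top, fun x => iff_of_true trivial (x.top_mem hS)⟩

theorem compl_mem_skeletalSets {U : Set (World S)} (hU : U ∈ skeletalSets S s) :
    Uᶜ ∈ skeletalSets S s :=
  let ⟨_, hb, h⟩ := hU
  ⟨_, hb.neg, fun x => (not_congr (h x)).trans (x.2.neg_mem_iff _).symm⟩

theorem inter_mem_skeletalSets (hS : K4 ≤ S) {U U' : Set (World S)} (hU : U ∈ skeletalSets S s)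
    (hU' : U' ∈ skeletalSets S s) : U ∩ U' ∈ skeletalSets S s :=
  let ⟨_, hb, h⟩ := hU
  let ⟨_, hb', h'⟩ := hU'
  ⟨_, hb.and hb', fun x => (and_congr (h x) (h' x)).trans (and_mem_iff hS).symm⟩

theorem boxPlus_mem_skeletalSets (hs : Function.Surjective s) (φ : CForm) :
    {x : World S | .boxPlus φ ∈ x.1} ∈ skeletalSets S s := by
  obtain ⟨n, rfl⟩ := hs φ
  exact ⟨_, .translation (.var n), fun x => Iff.rfl⟩

theorem box_mem_skeletalSets (hS : K4 ≤ S) (hs : Function.Surjective s) (φ : CForm) :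
    {x : World S | .box φ ∈ x.1} ∈ skeletalSets S s := by
  obtain ⟨n, rfl⟩ := hs φ
  refine ⟨_, .translation (.box (.var n)), fun x => ?_⟩
  change _ ↔ CForm.box (.boxPlus (s n)) ∈ x.1
  rw [Set.mem_ofPred_eq, ← sat_iff hS, ← sat_iff hS]
  exact ⟨fun h v hv => ⟨fun u hu => h u (rel_transitive hS _ _ _ hv hu), h v hv⟩,
    fun h v hv => (h v hv).2⟩

theorem passive_mem_skeletalSets (hS : K4 ≤ S) (hs : Function.Surjective s) (χ : CForm) :
    {x : World S | Passive χ x} ∈ skeletalSets S s := by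
  simp only [passive_iff hS]
  exact inter_mem_skeletalSets hS (boxPlus_mem_skeletalSets hs _)
    (compl_mem_skeletalSets (boxPlus_mem_skeletalSets hs _))

end SkeletalSets

/-- Finite types are definable. -/
theorem exists_type_formula (hS : K4 ≤ S) {A : Set CForm} (hA : A.Finite) (t : Set CForm) :
    ∃ χ, ∀ x : World S, x.1 ∩ A = t ↔ χ ∈ x.1 := by
  have h : {x : World S | x.1 ∩ A = t} ∈ definableSets S := by
    refine mem_of_determined (I := (fun φ => {x : World S | φ ∈ x.1}) '' A) (D := definableSets S)
      ⟨.top, fun x => iff_of_true trivial (x.top_mem hS)⟩ ?_ ?_ (hA.image _) ?_ _ ?_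
    · rintro U ⟨b, h⟩
      exact ⟨.neg b, fun x => (not_congr (h x)).trans (x.2.neg_mem_iff _).symm⟩
    · rintro U ⟨b, h⟩ U' ⟨b', h'⟩
      exact ⟨.and b b', fun x => (and_congr (h x) (h' x)).trans (and_mem_iff hS).symm⟩
    · rintro _ ⟨φ, -, rfl⟩
      exact ⟨φ, fun x => Iff.rfl⟩
    · rintro x y h rfl
      ext φ
      exact and_congr_left fun hφ => (h _ ⟨φ, hφ, rfl⟩).symm
  exact h

/-- A formula refutable in an extension of `K4.Grz` is refutable there after a substitution that
factors through skeletal formulae. -/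
theorem exists_skeletal_notMem (hS : K4Grz ≤ S) {φ : CForm} (hφ : φ ∉ S.theorems) :
    ∃ b s : ℕ → CForm, (∀ n, IsSkeletal (b n)) ∧ (φ.subst b).subst s ∉ S.theorems := by
  classical
  have hK := K4_le_K4Grz.trans hS
  obtain ⟨x₀, -, hx₀⟩ := (isTheory_theorems S).exists_world hK hφ
  have : Nonempty (World S) := ⟨x₀⟩
  -- Surjectivity makes every □⁺ψ the instance under s of some T(p), so all sets defined by
  -- □⁺-formulae are skeletal.
  obtain ⟨s, hs⟩ := exists_surjective_nat CForm
  set A : Set CForm := ↑φ.sub with hAdef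
  have hA : A.Finite := φ.sub.finite_toSet
  choose χ hχ using exists_type_formula hK hA
  let p (x : World S) : Prop := Passive (χ (x.1 ∩ A)) x
  -- The skeletal information kept about x. The □ component decides boxes at base points, and the □⁺
  -- component transfers truth from a successor to its base point.
  let κ (x : World S) : Set CForm × Set CForm :=
    ({ψ | CForm.box ψ ∈ A ∧ CForm.box ψ ∈ x.1}, {ψ | CForm.box ψ ∈ A ∧ CForm.boxPlus ψ ∈ x.1})
  have κ_eq {x y : World S} : κ x = κ y ↔ ∀ ψ, CForm.box ψ ∈ A →
      (CForm.box ψ ∈ x.1 ↔ CForm.box ψ ∈ y.1) ∧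
        (CForm.boxPlus ψ ∈ x.1 ↔ CForm.boxPlus ψ ∈ y.1) := by
    simp only [κ, Prod.mk.injEq, Set.ext_iff, Set.mem_ofPred_eq]
    grind
  -- For a point not passive for its own type, the choice depends only on κ, which keeps the
  -- valuation below skeletal.
  let base (x : World S) : World S := if p x then x else Function.invFun κ (κ x)
  have κ_base (x : World S) : κ (base x) = κ x := by
    by_cases h : p x
    · simp only [base, if_pos h]
    · simp only [base, if_neg h]
      exact Function.invFun_eq ⟨x, rfl⟩
  have base_of_p {x : World S} (h : p x) : base x = x := if_pos h
  have exists_p {x y : World S} (hxy : x.Rel y) : ∃ z, x.Rel z ∧ p z ∧ z.1 ∩ A = y.1 ∩ A := by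
    obtain ⟨z, hz, hp⟩ := exists_passive hS hxy ((hχ (y.1 ∩ A) y).1 rfl)
    have e := (hχ _ z).2 hp.1
    exact ⟨z, hz, by rwa [← e] at hp, e⟩
  let V (n : ℕ) (x : World S) : Prop := .var n ∈ A ∧ .var n ∈ (base x).1
  have hV (n : ℕ) : {x | V n x} ∈ skeletalSets S s := by
    have hbox : {ψ | CForm.box ψ ∈ A}.Finite :=
      hA.preimage (f := CForm.box) fun _ _ _ _ h => CForm.box.inj h
    refine mem_of_determined (I := (fun t => {x | Passive (χ t) x}) '' 𝒫 A ∪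
      ((fun ψ => {x : World S | CForm.box ψ ∈ x.1}) '' {ψ | CForm.box ψ ∈ A} ∪
        (fun ψ => {x : World S | CForm.boxPlus ψ ∈ x.1}) '' {ψ | CForm.box ψ ∈ A}))
      (univ_mem_skeletalSets hK) (fun _ => compl_mem_skeletalSets)
      (fun _ h _ h' => inter_mem_skeletalSets hK h h')
      ((hA.powerset.image _).union ((hbox.image _).union (hbox.image _))) ?_ _ ?_
    · rintro _ (⟨t, -, rfl⟩ | ⟨ψ, -, rfl⟩ | ⟨ψ, -, rfl⟩)
      exacts [passive_mem_skeletalSets hK hs _, box_mem_skeletalSets hK hs _,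
        boxPlus_mem_skeletalSets hs _]
    · rintro x y h ⟨hn, hx⟩
      have hκ : κ x = κ y := κ_eq.2 fun ψ hψ =>
        ⟨h _ (.inr (.inl ⟨ψ, hψ, rfl⟩)), h _ (.inr (.inr ⟨ψ, hψ, rfl⟩))⟩
      have hp (t : Set CForm) (ht : t ⊆ A) : Passive (χ t) x ↔ Passive (χ t) y :=
        h _ (.inl ⟨t, ht, rfl⟩)
      refine ⟨hn, ?_⟩
      by_cases hpx : p x
      · have hpy := (hp _ Set.inter_subset_right).1 hpx
        have e := (hχ _ y).2 hpy.1
        rw [← e] at hpy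
        rw [base_of_p hpx] at hx
        rw [base_of_p hpy]
        exact (e.symm.subset ⟨hx, hn⟩).1
      · have hpy : ¬ p y := fun hpy => by
          have hpx' := (hp _ Set.inter_subset_right).2 hpy
          have e := (hχ _ x).2 hpx'.1
          rw [← e] at hpx'
          exact hpx hpx'
        simp only [base, if_neg hpx] at hx
        simpa only [base, if_neg hpy, ← hκ] using hx
  have truth (ψ : CForm) (hψ : ψ.sub ⊆ φ.sub) (x : World S) :
      ψ.Sat Rel V x ↔ ψ ∈ (base x).1 := by
    induction ψ generalizing x with
    | var n => exact and_iff_right (hψ (CForm.mem_sub_self _))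
    | bot => exact ⟨False.elim, (base x).bot_notMem hK⟩
    | top => exact ⟨fun _ => (base x).top_mem hK, fun _ => trivial⟩
    | and α β h₁ h₂ =>
      refine (and_congr (h₁ ?_ x) (h₂ ?_ x)).trans (and_mem_iff hK).symm
      · exact fun γ hγ => hψ (by simp [CForm.sub, hγ])
      · exact fun γ hγ => hψ (by simp [CForm.sub, hγ])
    | neg α h =>
      refine (not_congr (h ?_ x)).trans ((base x).2.neg_mem_iff _).symm
      exact fun γ hγ => hψ (by simp [CForm.sub, hγ])
    | box α h =>
      have hsub : α.sub ⊆ φ.sub := fun γ hγ => hψ (by simp [CForm.sub, hγ])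
      have hαA : CForm.box α ∈ A := hψ (CForm.mem_sub_self _)
      rw [(κ_eq.1 (κ_base x) α hαA).1]
      simp only [Sat, h hsub]
      constructor
      -- A successor omitting α may be replaced by a passive successor of the same type, which is
      -- its own base point.
      · intro hx
        by_contra hn
        obtain ⟨y, hxy, hy⟩ := exists_rel hK hn
        obtain ⟨z, hxz, hz, e⟩ := exists_p hxy
        have hαz := hx z hxz
        rw [base_of_p hz] at hαz
        exact hy (e.subset ⟨hαz, hsub (CForm.mem_sub_self α)⟩).1
      -- A successor of x contains □⁺α by transitivity, and hence so does its base point.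
      · intro hx y hxy
        have hy : CForm.boxPlus α ∈ y.1 :=
          (boxPlus_mem_iff hK).2 ⟨hxy _ (box_box_mem hK hx), hxy _ hx⟩
        exact ((boxPlus_mem_iff hK).1 ((κ_eq.1 (κ_base y) α hαA).2.2 hy)).2
  -- The base point of x₀ might contain φ. But if x₀ is not passive, its type recurs above it, hence
  -- at a passive point, which still omits φ.
  obtain ⟨z, hz, hφz⟩ : ∃ z, p z ∧ φ ∉ z.1 := by
    by_cases hp : p x₀
    · exact ⟨x₀, hp, hx₀⟩
    · have hmem := (hχ (x₀.1 ∩ A) x₀).1 rfl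
      have hp' : ¬ ∀ y, x₀.Rel y → _ := fun h => hp ⟨hmem, h⟩
      push Not at hp'
      obtain ⟨y, hy, -, w, hw, hχw⟩ := hp'
      obtain ⟨z, -, hz, e⟩ := exists_p (rel_transitive hK _ _ _ hy hw)
      refine ⟨z, hz, fun h => hx₀ ?_⟩
      exact ((e.trans ((hχ _ w).2 hχw)).subset ⟨h, CForm.mem_sub_self φ⟩).1
  choose b hb hbV using hV
  refine ⟨b, s, hb, fun h => hφz ?_⟩
  rw [← base_of_p hz, ← truth φ subset_rfl z]
  have h' := (sat_iff hK _ z).2 (z.2.isTheory.theorems_subset h)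
  rw [sat_subst, sat_subst] at h'
  have e : V = fun n y => ((b n).subst s).Sat Rel val y :=
    funext₂ fun n y => propext ((hbV n y).trans (sat_iff hK _ y).symm)
  simpa only [e, sat_subst] using h'

end World

/-- A theorem φ of M missing from σρM would have a skeletal instance φ[b] with φ[b][s] missing too.
But □⁺(φ[b]) is equivalent to a translation in M, which σρM contains. -/
theorem sigma_rho {M : RuleSystem CForm} (hM : K4Grz ≤ M) (hM' : IsLogic M) :
    sigma (axiomatized (thm '' pullback M)) = M := by
  have hK := K4_le_K4Grz.trans hM
  have hL : IsLogic (axiomatized (thm '' pullback M)) := ⟨_, rfl⟩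
  have hle : sigma (axiomatized (thm '' pullback M)) ≤ M :=
    (sigma_le hL).2 ⟨hM, (theorems_rho hK hM').subset⟩
  have hG := ((sigma_le hL).1 le_rfl).1
  refine le_antisymm hle (hM'.le_iff.2 fun φ hφ => by_contra fun hn => ?_)
  obtain ⟨b, s, hb, h⟩ := World.exists_skeletal_notMem hG hn
  obtain ⟨α, hα⟩ := (IsSkeletal.subst hb φ).exists_boxPlus
  have hαM : α ∈ pullback M :=
    (mem_theorems_congr hK hα).1 ((boxPlus_mem_theorems hK).2 (M.theorems_subst b hφ))
  rw [← theorems_rho hK hM'] at hαM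
  have hαN := ((sigma_le hL).1 le_rfl).2 hαM
  have hK' := K4_le_K4Grz.trans hG
  exact h (RuleSystem.theorems_subst _ s
    ((boxPlus_mem_theorems hK').1 ((mem_theorems_congr hK' hα).2 hαN)))

end Worlds

/-- `σ` and `ρ` as mutually inverse order isomorphisms between intervals of logics. -/
def sigmaIso {L₀ : RuleSystem IForm} {M₀ : RuleSystem CForm} (hL₀ : mHC ≤ L₀) (hM₀ : K4Grz ≤ M₀)
    (hσ : ∀ L, IsLogic L → L₀ ≤ L → M₀ ≤ sigma L)
    (hρ : ∀ M, IsLogic M → M₀ ≤ M → L₀ ≤ axiomatized (thm '' pullback M)) :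
    NExtL L₀ ≃o NExtL M₀ where
  toFun L := ⟨sigma L.1, isLogic_sigma L.2.1, hσ L.1 L.2.1 L.2.2⟩
  invFun M := ⟨axiomatized (thm '' pullback M.1), ⟨_, rfl⟩, hρ M.1 M.2.1 M.2.2⟩
  left_inv L := Subtype.ext (by
    change axiomatized (thm '' pullback (sigma L.1)) = L.1
    rw [pullback_sigma (hL₀.trans L.2.2) L.2.1, ← L.2.1.eq_axiomatized])
  right_inv M := Subtype.ext (sigma_rho (hM₀.trans M.2.2) M.2.1)
  map_rel_iff' := by
    intro L L'
    change sigma L.1 ≤ sigma L'.1 ↔ L.1 ≤ L'.1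
    rw [sigma_le L.2.1, pullback_sigma (hL₀.trans L'.2.2) L'.2.1, ← L.2.1.le_iff]
    exact and_iff_right ((sigma_le L'.2.1).1 le_rfl).1

theorem exists_completeLatticeHom {L₀ : RuleSystem IForm} {M₀ : RuleSystem CForm}
    [Fact (IsLogic L₀)] [Fact (IsLogic M₀)] (hL₀ : mHC ≤ L₀) (hM₀ : K4Grz ≤ M₀)
    (hσ : ∀ L, IsLogic L → L₀ ≤ L → M₀ ≤ sigma L)
    (hρ : ∀ M, IsLogic M → M₀ ≤ M → L₀ ≤ axiomatized (thm '' pullback M)) :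
    ∃ (f : CompleteLatticeHom (NExtL L₀) (NExtL M₀))
      (g : CompleteLatticeHom (NExtL M₀) (NExtL L₀)),
      (∀ L, (f L).toRuleSystem = sigma L.toRuleSystem) ∧
      (∀ M, (g M).toRuleSystem.rules = rho M.toRuleSystem) ∧
      Function.LeftInverse g f ∧ Function.RightInverse g f :=
  let e := sigmaIso hL₀ hM₀ hσ hρ
  ⟨CompleteLatticeHom.OrderIso.toCompleteLatticeHom e,
    CompleteLatticeHom.OrderIso.toCompleteLatticeHom e.symm, fun _ => rfl,
    fun M => rho_eq (K4_le_K4Grz.trans (hM₀.trans M.2.2)) M.2.1, e.symm_apply_apply,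
    e.apply_symm_apply⟩

theorem mHC_le_rho {M : RuleSystem CForm} (hM : K4 ≤ M) (hM' : IsLogic M) :
    mHC ≤ axiomatized (thm '' pullback M) := by
  rw [IsLogic.le_iff Fact.out, theorems_rho hM hM']
  exact mHC_theorems_subset hM hM'

end KuzMur

theorem mainTheorem3 :
    (∃ (f : CompleteLatticeHom (KuzMur.NExtL KuzMur.KM) (KuzMur.NExtL KuzMur.GodelLob))
       (g : CompleteLatticeHom (KuzMur.NExtL KuzMur.GodelLob) (KuzMur.NExtL KuzMur.KM)),
      (∀ L, (f L).toRuleSystem = KuzMur.sigma L.toRuleSystem) ∧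
      (∀ M, (g M).toRuleSystem.rules = KuzMur.rho M.toRuleSystem) ∧
      Function.LeftInverse g f ∧ Function.RightInverse g f) ∧
    (∃ (f : CompleteLatticeHom (KuzMur.NExtL KuzMur.mHC) (KuzMur.NExtL KuzMur.K4Grz))
       (g : CompleteLatticeHom (KuzMur.NExtL KuzMur.K4Grz) (KuzMur.NExtL KuzMur.mHC)),
      (∀ L, (f L).toRuleSystem = KuzMur.sigma L.toRuleSystem) ∧
      (∀ M, (g M).toRuleSystem.rules = KuzMur.rho M.toRuleSystem) ∧
      Function.LeftInverse g f ∧ Function.RightInverse g f) := by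
  open KuzMur in
  refine ⟨exists_completeLatticeHom mHC_le_KM K4Grz_le_GodelLob (fun L hL h => ?_)
    (fun M hM h => ?_), exists_completeLatticeHom le_rfl le_rfl
    (fun L hL _ => ((sigma_le hL).1 le_rfl).1) (fun M hM h => mHC_le_rho (K4_le_K4Grz.trans h) hM)⟩
  · have hσ := (sigma_le hL).1 (le_refl (sigma L))
    have hK := K4_le_K4Grz.trans hσ.1
    exact GodelLob_le_iff.2 ⟨hK, mem_theorems_of_imp hK GL_of_T_KM (hσ.2 (KM_le_iff.1 h).2)⟩
  · have hK := K4_le_GodelLob.trans h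
    refine KM_le_iff.2 ⟨mHC_le_rho hK hM, ?_⟩
    rw [theorems_rho hK hM]
    exact KM_axiom_mem_pullback h
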